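/- Let $n\ge 2$, let $\Omega\subset\mathbb R^n$ be a bounded domain (non-empty, open, connected), let $d(x)=\operatorname{dist}(x,\partial\Omega)$ and let $p_0>1$. **Notions.** For a measurable exponent $q:\Omega\to(1,\infty)$, $\|f\|_{q(\cdot)}=\inf\{\lambda>0:\int_\Omega(|f(x)|/\lambda)^{q(x)}dx\le1\}$ is the Luxemburg norm of $L^{q(\cdot)}(\Omega)$ (for a matrix field, the norm of its Frobenius norm); $W^{1,q(\cdot)}(\Omega)$ is the space of $f\in W^{1,1}_{loc}(\Omega)$ with $f,\nabla f\in L^{q(\cdot)}(\Omega)$, and $W^{1,q(\cdot)}_0(\Omega)$ is the closure in it of the Lipschitz functions with compact support in $\Omega$. For $\tau\ge1$, $q\in\partial LH_0^\tau(\Omega)$ means that there is a $C_0$ with $$\operatorname*{ess\,sup}_{B(x,\tau d(x))\cap\Omega}q-\operatorname*{ess\,inf}_{B(x,\tau d(x))\cap\Omega}q\le\frac{C_0}{-\log(\tau d(x))}\quad\text{for all }x\in\Omega\text{ with }\tau d(x)\le\tfrac12,$$ and $q\in LH_0(\Omega)$ means that there is a $C_0$ with $|q(x)-q(y)|\le C_0/(-\log|x-y|)$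 for all $x,y\in\Omega$ with $|x-y|<\frac12$. We say that $q$ is *log-Hölder only at the boundary* if $q$ is uniformly continuous on $\Omega$, $1<\inf_\Omega q\le\sup_\Omega q<\infty$, $q\in\partial LH_0^\tau(\Omega)$ for every $\tau\ge1$, and $q\notin LH_0(\Omega)$. Write $\varepsilon(\mathbf u)=\frac12(\nabla\mathbf u+\nabla\mathbf u^T)$. The *Korn inequality holds in $L^{q(\cdot)}(\Omega)$* if there is a $C$ with $\|\nabla\mathbf u\|_{q(\cdot)}\le C\|\varepsilon(\mathbf u)\|_{q(\cdot)}$ for all $\mathbf u\in W^{1,q(\cdot)}(\Omega)^n$ with $\int_\Omega(\nabla\mathbf u-\varepsilon(\mathbf u))=0$. The *divergence equation is solvable in $L^{q(\cdot)}(\Omega)$* if there is a $C$ such that for every $f\in L^{q(\cdot)}(\Omega)$ with $\int_\Omega f=0$ there is $\mathbf v\in W^{1,q(\cdot)}_0(\Omega)^n$ with $\operatorname{div}\mathbf v=f$ and $\|\nabla\mathbf v\|_{q(\cdot)}\le C\|f\|_{q(\cdot)}$. **Construction.** An admissible configuration consists of $r_k\in(0,1)$ and $c_k,a_k,b_k\in\mathbb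 R^n$ ($k\in\mathbb N$) such that the balls $B(c_k,7r_k)$ are pairwise disjoint, contained in $\Omega$ and at distance more than some $\mu>0$, independent of $k$, from $\partial\Omega$, and $B(a_k,3r_k)$, $B(b_k,3r_k)$ are disjoint subsets of $B(c_k,7r_k)$. Given one, let $p_k=p_0+|\log r_k|^{-1/2}$, and let $p(x)=p_k$ on $B(a_k,r_k)\cup B(b_k,r_k)$, $$p(x)=\frac{|x-z|-r_k}{r_k}\,p_0+\frac{2r_k-|x-z|}{r_k}\,p_k\quad\text{if } r_k\le|x-z|<2r_k,\ z\in\{a_k,b_k\},$$ and $p(x)=p_0$ at all other points. Let $S$ be the skew-symmetric $n\times n$ matrix with $S_{12}=-1$, $S_{21}=1$ and all other entries $0$, and let $\mathbf u_k(x)=S(x-a_k)$ if $|x-a_k|<2r_k$; $\mathbf u_k(x)=(3-|x-a_k|/r_k)\,S(x-a_k)$ if $2r_k\le|x-a_k|<3r_k$; $\mathbf u_k(x)=-S(x-b_k)$ if $|x-b_k|<2r_k$; $\mathbf u_k(x)=-(3-|x-b_k|/r_k)\,S(x-b_k)$ if $2r_k\le|x-b_k|<3r_k$; and $\mathbf u_k(x)=0$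 otherwise. **Theorem.** Admissible configurations exist. For every admissible configuration: 1. $p$ is log-Hölder only at the boundary, and $p\ge p_0$ on $\Omega$. 2. For every $k$, $\mathbf u_k\in W^{1,p(\cdot)}(\Omega)^n$, $\int_\Omega(\nabla\mathbf u_k-\varepsilon(\mathbf u_k))=0$ and $0<\|\varepsilon(\mathbf u_k)\|_{p(\cdot)}<\infty$. There is $\kappa>0$ such that, for all $k$, $$\frac{\|\nabla\mathbf u_k\|_{p(\cdot)}}{\|\varepsilon(\mathbf u_k)\|_{p(\cdot)}}\ge\kappa\, r_k^{\,n/p_k-n/p_0},$$ and the quotient on the left tends to $\infty$ as $k\to\infty$. Hence the Korn inequality does not hold in $L^{p(\cdot)}(\Omega)$. 3. The dual exponent $p'(\cdot)$, $\frac1{p(x)}+\frac1{p'(x)}=1$, is also log-Hölder only at the boundary, and the divergence equation is not solvable in $L^{p'(\cdot)}(\Omega)$. Moreover, there is one exponent $q$ on $\Omega$, log-Hölder only at the boundary, such that the Korn inequality does not hold in $L^{q(\cdot)}(\Omega)$ and the divergence equation is not solvable in $L^{q(\cdot)}(\Omega)$. -/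

import Mathlib

open MeasureTheory Metric Set Filter Topology
open scoped ENNReal NNReal ContDiff

noncomputable section

/-- Euclidean space `ℝⁿ`. -/
abbrev Rn (n : ℕ) : Type := EuclideanSpace ℝ (Fin n)

/-! ### Variable Lebesgue spaces

Exponents are real valued functions; only their values on `Ω` matter. -/

/-- The modular `∫_Ω |f(x)|^{p(x)} dx` of a finite exponent. -/
def modular {n : ℕ} (Ω : Set (Rn n)) (p : Rn n → ℝ) (f : Rn n → ℝ) : ℝ≥0∞ :=
  ∫⁻ x in Ω, ‖f x‖ₑ ^ p x

/-- The Luxemburg norm `inf {t > 0 : ρ(f / t) ≤ 1}`, with value `∞` if there is no such `t`. -/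
def luxNorm {n : ℕ} (Ω : Set (Rn n)) (p : Rn n → ℝ) (f : Rn n → ℝ) : ℝ≥0∞ :=
  ⨅ (t : ℝ) (_ : 0 < t) (_ : modular Ω p (fun x => f x / t) ≤ 1), ENNReal.ofReal t

/-- Membership in `L^{p(·)}(Ω)`. -/
def MemVarLp {n : ℕ} (Ω : Set (Rn n)) (p : Rn n → ℝ) (f : Rn n → ℝ) : Prop :=
  AEMeasurable f (volume.restrict Ω) ∧ ∃ t : ℝ, 0 < t ∧ modular Ω p (fun x => f x / t) < ⊤

/-- The conjugate exponent, `1 / p(x) + 1 / p'(x) = 1` (used where `1 < p(x) < ∞`). -/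
def conjExponent {n : ℕ} (p : Rn n → ℝ) : Rn n → ℝ := fun x => p x / (p x - 1)

/-! ### Continuity conditions on exponents -/

/-- `p₊(E)`, for an exponent that is essentially bounded on `E`. -/
def expSup {n : ℕ} (p : Rn n → ℝ) (E : Set (Rn n)) : ℝ := essSup p (volume.restrict E)

/-- `p₋(E)`, for an exponent that is essentially bounded on `E`. -/
def expInf {n : ℕ} (p : Rn n → ℝ) (E : Set (Rn n)) : ℝ := essInf p (volume.restrict E)

/-- The distance `d(x)` of `x` to the boundary of `Ω`. -/
def bdryDist {n : ℕ} (Ω : Set (Rn n)) (x : Rn n) : ℝ := infDist x (frontier Ω)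

/-- The boundary log-Hölder condition `∂LH₀^τ(Ω)`. -/
def BoundaryLH {n : ℕ} (Ω : Set (Rn n)) (τ : ℝ) (p : Rn n → ℝ) : Prop :=
  ∃ C₀ : ℝ, ∀ x ∈ Ω, τ * bdryDist Ω x ≤ 1 / 2 →
    expSup p (ball x (τ * bdryDist Ω x) ∩ Ω) - expInf p (ball x (τ * bdryDist Ω x) ∩ Ω)
      ≤ C₀ / (-Real.log (τ * bdryDist Ω x))

/-- The (interior) log-Hölder condition `LH₀(Ω)`. -/
def InteriorLH {n : ℕ} (Ω : Set (Rn n)) (p : Rn n → ℝ) : Prop :=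
  ∃ C₀ : ℝ, ∀ x ∈ Ω, ∀ y ∈ Ω, dist x y < 1 / 2 → |p x - p y| ≤ C₀ / (-Real.log (dist x y))

/-- `p` is uniformly continuous on `Ω`, is bounded away from `1` and `∞` on `Ω`, satisfies
`∂LH₀^τ(Ω)` for every `τ ≥ 1`, and does not satisfy `LH₀(Ω)`. -/
def OnlyBoundaryLH {n : ℕ} (Ω : Set (Rn n)) (p : Rn n → ℝ) : Prop :=
  UniformContinuousOn p Ω ∧
  (∃ m M : ℝ, 1 < m ∧ ∀ x ∈ Ω, m ≤ p x ∧ p x ≤ M) ∧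
  (∀ τ : ℝ, 1 ≤ τ → BoundaryLH Ω τ p) ∧
  ¬ InteriorLH Ω p

/-! ### Sobolev spaces -/

/-- `f` and `g` are locally integrable on `Ω`, and `g` is the weak derivative `∂f/∂x_j` there. -/
def HasWeakPartial {n : ℕ} (Ω : Set (Rn n)) (f : Rn n → ℝ) (j : Fin n) (g : Rn n → ℝ) : Prop :=
  LocallyIntegrableOn f Ω ∧ LocallyIntegrableOn g Ω ∧
  ∀ φ : Rn n → ℝ, ContDiff ℝ ∞ φ → HasCompactSupport φ → tsupport φ ⊆ Ω →
    ∫ x in Ω, f x * fderiv ℝ φ x (EuclideanSpace.single j 1) = - ∫ x in Ω, g x * φ x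

/-- `g` is the weak gradient of `f` in `Ω`. -/
def HasWeakGradient {n : ℕ} (Ω : Set (Rn n)) (f : Rn n → ℝ) (g : Rn n → Rn n) : Prop :=
  ∀ j, HasWeakPartial Ω f j (fun x => g x j)

/-- `f ∈ W^{1,p(·)}(Ω)`, with weak gradient `g`. -/
def MemW {n : ℕ} (Ω : Set (Rn n)) (p : Rn n → ℝ) (f : Rn n → ℝ) (g : Rn n → Rn n) : Prop :=
  HasWeakGradient Ω f g ∧ MemVarLp Ω p f ∧ ∀ j, MemVarLp Ω p (fun x => g x j)

/-- `f ∈ W₀^{1,p(·)}(Ω)`, with weak gradient `g`: `f` is in the closure, in `W^{1,p(·)}(Ω)`,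
of the Lipschitz functions with compact support in `Ω`. -/
def MemW0 {n : ℕ} (Ω : Set (Rn n)) (p : Rn n → ℝ) (f : Rn n → ℝ) (g : Rn n → Rn n) : Prop :=
  MemW Ω p f g ∧
  ∀ δ : ℝ≥0∞, 0 < δ → ∃ (φ : Rn n → ℝ) (h : Rn n → Rn n),
    (∃ K : ℝ≥0, LipschitzWith K φ) ∧ HasCompactSupport φ ∧ tsupport φ ⊆ Ω ∧
    MemW Ω p φ h ∧
    luxNorm Ω p (fun x => f x - φ x) + luxNorm Ω p (fun x => ‖g x - h x‖) < δ

/-- The `i`-th row of a matrix field. -/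
def rowField {n : ℕ} (G : Rn n → Matrix (Fin n) (Fin n) ℝ) (i : Fin n) : Rn n → Rn n :=
  fun x => WithLp.toLp 2 (G x i)

/-- `u ∈ W^{1,p(·)}(Ω)ⁿ`, with weak differential matrix `G`, `G_ij = ∂u_i/∂x_j`. -/
def MemWVec {n : ℕ} (Ω : Set (Rn n)) (p : Rn n → ℝ) (u : Rn n → Rn n)
    (G : Rn n → Matrix (Fin n) (Fin n) ℝ) : Prop :=
  ∀ i, MemW Ω p (fun x => u x i) (rowField G i)

/-- `u ∈ W₀^{1,p(·)}(Ω)ⁿ`, with weak differential matrix `G`, `G_ij = ∂u_i/∂x_j`. -/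
def MemW0Vec {n : ℕ} (Ω : Set (Rn n)) (p : Rn n → ℝ) (u : Rn n → Rn n)
    (G : Rn n → Matrix (Fin n) (Fin n) ℝ) : Prop :=
  ∀ i, MemW0 Ω p (fun x => u x i) (rowField G i)

/-! ### Korn inequality and divergence equation -/

/-- The symmetric part of a matrix; applied to `∇u` it gives `ε(u)`. -/
def symPart {n : ℕ} (M : Matrix (Fin n) (Fin n) ℝ) : Matrix (Fin n) (Fin n) ℝ :=
  Matrix.of fun i j => (M i j + M j i) / 2

/-- The Euclidean (Frobenius) norm of a matrix. -/
def frob {n : ℕ} (M : Matrix (Fin n) (Fin n) ℝ) : ℝ := √(∑ i, ∑ j, M i j ^ 2)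

/-- The norm of a matrix field in `L^{p(·)}(Ω)^{n×n}`. -/
def matNorm {n : ℕ} (Ω : Set (Rn n)) (p : Rn n → ℝ)
    (G : Rn n → Matrix (Fin n) (Fin n) ℝ) : ℝ≥0∞ :=
  luxNorm Ω p (fun x => frob (G x))

/-- `∫_Ω (∇u - ε(u)) = 0`, for `G = ∇u`. -/
def SkewMeanZero {n : ℕ} (Ω : Set (Rn n)) (G : Rn n → Matrix (Fin n) (Fin n) ℝ) : Prop :=
  ∀ i j, ∫ x in Ω, (G x i j - symPart (G x) i j) = 0

/-- The Korn inequality in `L^{p(·)}(Ω)`. -/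
def KornInequality {n : ℕ} (Ω : Set (Rn n)) (p : Rn n → ℝ) : Prop :=
  ∃ C : ℝ≥0, ∀ (u : Rn n → Rn n) (G : Rn n → Matrix (Fin n) (Fin n) ℝ),
    MemWVec Ω p u G → SkewMeanZero Ω G →
      matNorm Ω p G ≤ C * matNorm Ω p (fun x => symPart (G x))

/-- Solvability of the divergence equation in `L^{p(·)}(Ω)`, with the gradient estimate. -/
def DivergenceSolvable {n : ℕ} (Ω : Set (Rn n)) (p : Rn n → ℝ) : Prop :=
  ∃ C : ℝ≥0, ∀ f : Rn n → ℝ, MemVarLp Ω p f → ∫ x in Ω, f x = 0 →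
    ∃ (v : Rn n → Rn n) (V : Rn n → Matrix (Fin n) (Fin n) ℝ),
      MemW0Vec Ω p v V ∧ (∀ᵐ x ∂(volume.restrict Ω), (V x).trace = f x) ∧
      matNorm Ω p V ≤ C * luxNorm Ω p f

/-! ### The exponent and the vector fields -/

/-- Disjoint balls `B(c_k, 7r_k)` in `Ω`, uniformly far from the boundary of `Ω`, each containing
two disjoint balls `B(a_k, 3r_k)` and `B(b_k, 3r_k)`. -/
structure BallConfiguration {n : ℕ} (Ω : Set (Rn n)) where
  /-- centres of the large balls -/
  c : ℕ → Rn n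
  /-- centres of the first small balls -/
  a : ℕ → Rn n
  /-- centres of the second small balls -/
  b : ℕ → Rn n
  /-- radii -/
  r : ℕ → ℝ
  r_pos : ∀ k, 0 < r k
  r_lt_one : ∀ k, r k < 1
  disjoint_balls : Pairwise fun k l => Disjoint (ball (c k) (7 * r k)) (ball (c l) (7 * r l))
  ball_subset : ∀ k, ball (c k) (7 * r k) ⊆ Ω
  far_from_boundary : ∃ μ : ℝ, 0 < μ ∧ ∀ k, ∀ x ∈ ball (c k) (7 * r k), μ < bdryDist Ω x
  ball_a_subset : ∀ k, ball (a k) (3 * r k) ⊆ ball (c k) (7 * r k)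
  ball_b_subset : ∀ k, ball (b k) (3 * r k) ⊆ ball (c k) (7 * r k)
  disjoint_ab : ∀ k, Disjoint (ball (a k) (3 * r k)) (ball (b k) (3 * r k))

/-- The radial profile: `p₁` for `t < r`, `p₀` for `t ≥ 2r`, and affine in between. -/
def radialExponent (p₀ p₁ r t : ℝ) : ℝ :=
  if t < r then p₁
  else if t < 2 * r then (t - r) / r * p₀ + (2 * r - t) / r * p₁
  else p₀

namespace BallConfiguration

variable {n : ℕ} {Ω : Set (Rn n)}

/-- `p_k = p₀ + |log r_k|^{-1/2}`. -/
def level (B : BallConfiguration Ω) (p₀ : ℝ) (k : ℕ) : ℝ :=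
  p₀ + 1 / √|Real.log (B.r k)|

open Classical in
/-- The exponent in the ball `B(c_k, 7r_k)`. -/
def localExponent (B : BallConfiguration Ω) (p₀ : ℝ) (k : ℕ) (x : Rn n) : ℝ :=
  if x ∈ ball (B.a k) (3 * B.r k) then
    radialExponent p₀ (B.level p₀ k) (B.r k) (dist x (B.a k))
  else if x ∈ ball (B.b k) (3 * B.r k) then
    radialExponent p₀ (B.level p₀ k) (B.r k) (dist x (B.b k))
  else p₀

open Classical in
/-- The exponent `p(·)`; the `k` below is unique because the balls are disjoint. -/
def exponent (B : BallConfiguration Ω) (p₀ : ℝ) (x : Rn n) : ℝ :=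
  if h : ∃ k, x ∈ ball (B.c k) (7 * B.r k) then B.localExponent p₀ h.choose x else p₀

theorem exponent_of_mem (B : BallConfiguration Ω) (p₀ : ℝ) {k : ℕ} {x : Rn n}
    (hx : x ∈ ball (B.c k) (7 * B.r k)) : B.exponent p₀ x = B.localExponent p₀ k x := by
  have h : ∃ k, x ∈ ball (B.c k) (7 * B.r k) := ⟨k, hx⟩
  have hk : h.choose = k := by
    by_contra hne
    exact Set.disjoint_left.mp (B.disjoint_balls hne) h.choose_spec hx
  rw [exponent, dif_pos h, hk]

theorem exponent_of_notMem (B : BallConfiguration Ω) (p₀ : ℝ) {x : Rn n}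
    (hx : ∀ k, x ∉ ball (B.c k) (7 * B.r k)) : B.exponent p₀ x = p₀ :=
  dif_neg (by push Not; exact hx)

/-- The skew-symmetric matrix with `S₁₂ = -1`, `S₂₁ = 1` and all other entries `0`
(the indices of `Fin n` start at `0`). -/
def rotMatrix (n : ℕ) : Matrix (Fin n) (Fin n) ℝ :=
  Matrix.of fun i j =>
    if i.val = 0 ∧ j.val = 1 then -1 else if i.val = 1 ∧ j.val = 0 then 1 else 0

/-- `x ↦ S · x`. -/
def rot (x : Rn n) : Rn n := WithLp.toLp 2 ((rotMatrix n).mulVec x.ofLp)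

open Classical in
/-- The vector field `u_k`. -/
def field (B : BallConfiguration Ω) (k : ℕ) (x : Rn n) : Rn n :=
  if x ∈ ball (B.a k) (2 * B.r k) then rot (x - B.a k)
  else if x ∈ ball (B.a k) (3 * B.r k) then
    (3 - dist x (B.a k) / B.r k) • rot (x - B.a k)
  else if x ∈ ball (B.b k) (2 * B.r k) then -rot (x - B.b k)
  else if x ∈ ball (B.b k) (3 * B.r k) then
    -((3 - dist x (B.b k) / B.r k) • rot (x - B.b k))
  else 0

end BallConfiguration

end

/-! ### Luxemburg norms -/

section Luxemburg

variable {n : ℕ} {Ω E : Set (Rn n)} {q : Rn n → ℝ} {f : Rn n → ℝ}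

/-! A field that rotates rigidly on a small ball and is cut off outside it has full gradient on the
ball and symmetric gradient only in the surrounding annulus. In `L^{q(·)}` a bounded function living
on a set of size `r^n`, with constant exponent `s` there, has norm of order `r^(n/s)`. The exponent
is therefore made slightly larger on the core `B(a_k, r_k)`, where it equals `p_k`, than on the
annulus between `2r_k` and `3r_k`, where it equals `p₀`. The Korn quotient of `u_k` is then at least
a constant times `r_k^(n/p_k - n/p₀) = exp(n √|log r_k| / (p_k p₀))`, which blows up. The second
ball, with the opposite rotation, makes the field a symmetric pair to which a mean-zero right-hand
side can be matched below.

The increment `|log r_k|^(-1/2)` is chosen between two scales. It tends to `0`, because disjoint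
balls in a bounded set have radii tending to `0`; hence `p` is uniformly continuous. But it is much
larger than `1/|log r_k|`, so the interior log-Hölder condition fails. The boundary condition holds
because `p` is constant near the boundary.

For the divergence equation take `f = 1_{B(a_k, r_k)} - 1_{B(b_k, r_k)}`. If `div v = f`, pair `∇v`
with the gradient of a smooth version `w` of `u_k` through the null Lagrangian `kornForm`. Its
integral vanishes, since `w` has compact support and derivatives may be exchanged. Where `∇w = ±S`
it is `±2 div v = ±2f`, and the two signs agree on the two balls. So twice the volume of the cores
is controlled by `∫ |∇v|` over the annuli. Hölder's inequality there and the assumed bound by `‖f‖`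
give `r_k^(n/p_k) ≤ c r_k^(n/p₀)` with `c` independent of `k`, contradicting the same blow-up. The
carrying lemmas are `tendsto_r_rpow_atTop`, `exists_quotient_lower_bound`,
`integrableOn_kornForm_and_integral_eq_zero` and `two_mul_volume_cores_le`.

Both arguments see the exponent only inside the balls. Using exponents of the first kind in half of
the balls and dual ones in the other half gives one exponent for which both statements fail. -/

theorem luxNorm_le_ofReal {t : ℝ} (ht : 0 < t) (h : modular Ω q (fun x => f x / t) ≤ 1) :
    luxNorm Ω q f ≤ ENNReal.ofReal t :=
  iInf_le_of_le t (iInf_le_of_le ht (iInf_le_of_le h le_rfl))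

theorem modular_div_anti (hΩ : MeasurableSet Ω) (hq : ∀ x ∈ Ω, 0 ≤ q x) {s t : ℝ} (hs : 0 < s)
    (hst : s ≤ t) : modular Ω q (fun x => f x / t) ≤ modular Ω q (fun x => f x / s) := by
  refine setLIntegral_mono' hΩ fun x hx => ?_
  refine ENNReal.rpow_le_rpow ?_ (hq x hx)
  rw [Real.enorm_eq_ofReal_abs, Real.enorm_eq_ofReal_abs, abs_div, abs_div, abs_of_pos hs,
    abs_of_pos (hs.trans_le hst)]
  exact ENNReal.ofReal_le_ofReal (div_le_div_of_nonneg_left (abs_nonneg _) hs hst)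

theorem modular_le_one_of_luxNorm_lt (hΩ : MeasurableSet Ω) (hq : ∀ x ∈ Ω, 0 ≤ q x) {t : ℝ}
    (h : luxNorm Ω q f < ENNReal.ofReal t) : modular Ω q (fun x => f x / t) ≤ 1 := by
  simp only [luxNorm, iInf_lt_iff] at h
  obtain ⟨s, hs, hm, hst⟩ := h
  exact (modular_div_anti hΩ hq hs (ENNReal.ofReal_lt_ofReal_iff'.mp hst).1.le).trans hm

/-- Every admissible `t` satisfies `(δ/t)^s |E| ≤ 1`, by discarding the part of the modular outside
`E`. Only the values of `q` on `E` matter, which lets the exponent vary elsewhere. -/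
theorem le_luxNorm_of_le_abs_on (hE : MeasurableSet E) (hEΩ : E ⊆ Ω) {s δ : ℝ}
    (hs : 0 < s) (hq : ∀ x ∈ E, q x = s) (hf : ∀ x ∈ E, δ ≤ |f x|) :
    ENNReal.ofReal δ * volume E ^ (1 / s) ≤ luxNorm Ω q f := by
  refine le_iInf fun t => le_iInf fun ht => le_iInf fun hm => ?_
  have h1 : ENNReal.ofReal (δ / t) ^ s * volume E ≤ 1 := by
    rw [← setLIntegral_const]
    refine le_trans (setLIntegral_mono' (g := fun x => ‖f x / t‖ₑ ^ q x) hE fun x hx => ?_)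
      ((lintegral_mono_set hEΩ).trans hm)
    rw [hq x hx]
    refine ENNReal.rpow_le_rpow ?_ hs.le
    rw [Real.enorm_eq_ofReal_abs, abs_div, abs_of_pos ht]
    exact ENNReal.ofReal_le_ofReal (div_le_div_of_nonneg_right (hf x hx) ht.le)
  have h2 : ENNReal.ofReal (δ / t) * volume E ^ (1 / s) ≤ 1 := by
    have h3 := ENNReal.rpow_le_rpow h1 (one_div_pos.mpr hs).le
    rwa [ENNReal.mul_rpow_of_nonneg _ _ (one_div_pos.mpr hs).le, ← ENNReal.rpow_mul,
      mul_one_div_cancel hs.ne', ENNReal.rpow_one, ENNReal.one_rpow] at h3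
  calc ENNReal.ofReal δ * volume E ^ (1 / s)
      = ENNReal.ofReal t * (ENNReal.ofReal (δ / t) * volume E ^ (1 / s)) := by
        rw [← mul_assoc, ← ENNReal.ofReal_mul ht.le, mul_div_cancel₀ _ ht.ne']
    _ ≤ ENNReal.ofReal t * 1 := by gcongr
    _ = ENNReal.ofReal t := mul_one _

/-- The number `t = K |E|^(1/s)` is the one with `(K/t)^s |E| = 1`, so it is admissible. Vanishing
off `E` is asked only almost everywhere, since gradients of piecewise defined fields are not
controlled on the interfaces. -/
theorem luxNorm_le_of_abs_le_on (hΩ : MeasurableSet Ω) (hE : MeasurableSet E) {s K : ℝ}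
    (hs : 0 < s) (hK : 0 < K) (hE0 : volume E ≠ 0) (hEt : volume E ≠ ⊤)
    (hqpos : ∀ x ∈ Ω, 0 < q x) (hq : ∀ x ∈ E, q x = s) (hf : ∀ x ∈ E, |f x| ≤ K)
    (hf0 : ∀ᵐ x, x ∈ Ω → x ∉ E → f x = 0) :
    luxNorm Ω q f ≤ ENNReal.ofReal K * volume E ^ (1 / s) := by
  have hEpos : 0 < (volume E).toReal := ENNReal.toReal_pos hE0 hEt
  set t : ℝ := K * (volume E).toReal ^ (1 / s) with ht
  have htpos : 0 < t := mul_pos hK (Real.rpow_pos_of_pos hEpos _)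
  have hteq : ENNReal.ofReal t = ENNReal.ofReal K * volume E ^ (1 / s) := by
    rw [ht, ENNReal.ofReal_mul hK.le, ← ENNReal.ofReal_rpow_of_pos hEpos, ENNReal.ofReal_toReal hEt]
  rw [← hteq]
  refine luxNorm_le_ofReal htpos ?_
  have hle : modular Ω q (fun x => f x / t) ≤
      ∫⁻ x in Ω, E.indicator (fun _ => ENNReal.ofReal (K / t) ^ s) x := by
    refine setLIntegral_mono_ae' hΩ ?_
    filter_upwards [hf0] with x hx0 hxΩ
    by_cases hxE : x ∈ E
    · rw [indicator_of_mem hxE, hq x hxE]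
      refine ENNReal.rpow_le_rpow ?_ hs.le
      rw [Real.enorm_eq_ofReal_abs, abs_div, abs_of_pos htpos]
      exact ENNReal.ofReal_le_ofReal (div_le_div_of_nonneg_right (hf x hxE) htpos.le)
    · rw [hx0 hxΩ hxE, zero_div, enorm_zero, ENNReal.zero_rpow_of_pos (hqpos x hxΩ)]
      exact zero_le
  refine hle.trans ((setLIntegral_le_lintegral _ _).trans ?_)
  rw [lintegral_indicator hE, setLIntegral_const, ENNReal.ofReal_rpow_of_pos (div_pos hK htpos)]
  have h1 : (K / t) ^ s = (volume E).toReal⁻¹ := by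
    rw [ht, div_mul_eq_div_div, div_self hK.ne', one_div, Real.inv_rpow (by positivity),
      ← Real.rpow_mul hEpos.le, one_div_mul_cancel hs.ne', Real.rpow_one]
  rw [h1, ENNReal.ofReal_inv_of_pos hEpos, ENNReal.ofReal_toReal hEt,
    ENNReal.inv_mul_cancel hE0 hEt]

theorem memVarLp_of_abs_le (hΩ : MeasurableSet Ω) (hΩt : volume Ω ≠ ⊤) (hq : ∀ x ∈ Ω, 0 ≤ q x)
    (hf : AEMeasurable f (volume.restrict Ω)) {K : ℝ} (hK : ∀ x, |f x| ≤ K) :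
    MemVarLp Ω q f := by
  -- Dividing by any number `≥ K` makes the integrand at most `1`; the `1` in the maximum only
  -- ensures positivity.
  refine ⟨hf, max K 1, by positivity, ?_⟩
  refine lt_of_le_of_lt (setLIntegral_mono' (g := fun _ => 1) hΩ fun x hx => ?_) ?_
  · refine ENNReal.rpow_le_one ?_ (hq x hx)
    rw [Real.enorm_eq_ofReal_abs, abs_div, abs_of_pos (show (0:ℝ) < max K 1 by positivity)]
    refine ENNReal.ofReal_le_one.mpr (div_le_one_of_le₀ ((hK x).trans (le_max_left _ _)) ?_)
    positivity
  · simpa using hΩt.lt_top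

end Luxemburg

theorem volume_ball_Rn {n : ℕ} (hn : n ≠ 0) (x : Rn n) {r : ℝ} (hr : 0 ≤ r) :
    volume (ball x r) = ENNReal.ofReal (r ^ n) * volume (ball (0 : Rn n) 1) := by
  have : Nonempty (Fin n) := ⟨⟨0, Nat.pos_of_ne_zero hn⟩⟩
  have h := Measure.addHaar_ball (volume : Measure (Rn n)) x hr
  simpa using h

/-! ### The exponent -/

/-- The Lipschitz cut-off which is `1` for `t ≤ r` and `0` for `2 * r ≤ t`. -/
noncomputable def cutoff (r t : ℝ) : ℝ := max 0 (min 1 (2 - t / r))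

theorem cutoff_nonneg (r t : ℝ) : 0 ≤ cutoff r t := le_max_left _ _

theorem cutoff_le_one (r t : ℝ) : cutoff r t ≤ 1 := max_le zero_le_one (min_le_left _ _)

theorem cutoff_of_le {r t : ℝ} (hr : 0 < r) (h : t ≤ r) : cutoff r t = 1 := by
  have : t / r ≤ 1 := (div_le_one hr).mpr h
  rw [cutoff, min_eq_left (by linarith), max_eq_right zero_le_one]

theorem cutoff_of_two_mul_le {r t : ℝ} (hr : 0 < r) (h : 2 * r ≤ t) : cutoff r t = 0 := by
  have : 2 ≤ t / r := (le_div_iff₀ hr).mpr h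
  rw [cutoff, max_eq_left]
  exact (min_le_right _ _).trans (by linarith)

/-- The piecewise profile is a clipped affine function, and in this form its continuity is
immediate. -/
theorem radialExponent_eq {p₀ p₁ r t : ℝ} (hr : 0 < r) :
    radialExponent p₀ p₁ r t = p₀ + (p₁ - p₀) * cutoff r t := by
  unfold radialExponent
  split_ifs with h1 h2
  · rw [cutoff_of_le hr h1.le]; ring
  · have h3 : 1 ≤ t / r := (one_le_div hr).mpr (not_lt.mp h1)
    have h4 : t / r ≤ 2 := (div_le_iff₀ hr).mpr h2.le
    rw [cutoff, min_eq_right (by linarith), max_eq_right (by linarith)]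
    field_simp
    ring
  · rw [cutoff_of_two_mul_le hr (not_lt.mp h2)]; ring

theorem uniformContinuous_cutoff_dist {n : ℕ} (z : Rn n) {r : ℝ} :
    UniformContinuous fun x : Rn n => cutoff r (dist x z) := by
  have h1 : LipschitzWith (Real.toNNReal |r⁻¹|) fun x : Rn n => dist x z / r := by
    refine LipschitzWith.of_dist_le_mul fun x y => ?_
    rw [Real.coe_toNNReal _ (abs_nonneg _), Real.dist_eq, ← sub_div, div_eq_inv_mul, abs_mul]
    exact mul_le_mul_of_nonneg_left (abs_dist_sub_le x y z) (abs_nonneg _)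
  have h2 := (((LipschitzWith.const (2 : ℝ)).sub h1).const_min 1).const_max 0
  exact h2.uniformContinuous

namespace BallConfiguration

variable {n : ℕ} {Ω : Set (Rn n)} (B : BallConfiguration Ω) (p₀ : ℝ)

/-- The sum of the two cut-off functions in the `k`-th ball. -/
noncomputable def bump (k : ℕ) (x : Rn n) : ℝ :=
  cutoff (B.r k) (dist x (B.a k)) + cutoff (B.r k) (dist x (B.b k))

theorem notMem_a_or_notMem_b (k : ℕ) (x : Rn n) :
    3 * B.r k ≤ dist x (B.a k) ∨ 3 * B.r k ≤ dist x (B.b k) := by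
  by_contra! h
  exact Set.disjoint_left.mp (B.disjoint_ab k) (mem_ball.mpr h.1) (mem_ball.mpr h.2)

theorem bump_nonneg (k : ℕ) (x : Rn n) : 0 ≤ B.bump k x :=
  add_nonneg (cutoff_nonneg _ _) (cutoff_nonneg _ _)

theorem bump_le_one (k : ℕ) (x : Rn n) : B.bump k x ≤ 1 := by
  have hr := B.r_pos k
  unfold bump
  rcases B.notMem_a_or_notMem_b k x with h | h
  · rw [cutoff_of_two_mul_le hr (by linarith), zero_add]; exact cutoff_le_one _ _
  · rw [cutoff_of_two_mul_le (t := dist x (B.b k)) hr (by linarith), add_zero]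
    exact cutoff_le_one _ _

theorem bump_of_notMem {k : ℕ} {x : Rn n} (hx : x ∉ ball (B.c k) (7 * B.r k)) :
    B.bump k x = 0 := by
  have hr := B.r_pos k
  have ha : ¬ dist x (B.a k) < 3 * B.r k := fun h => hx (B.ball_a_subset k h)
  have hb : ¬ dist x (B.b k) < 3 * B.r k := fun h => hx (B.ball_b_subset k h)
  rw [bump, cutoff_of_two_mul_le hr (by linarith), cutoff_of_two_mul_le hr (by linarith), add_zero]

/-- The `3r`-balls about `a_k` and `b_k` are disjoint, so at most one cut-off is nonzero at any
point and the case distinction becomes a sum. -/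
theorem exponent_eq {k : ℕ} {x : Rn n} (hx : x ∈ ball (B.c k) (7 * B.r k)) :
    B.exponent p₀ x = p₀ + (B.level p₀ k - p₀) * B.bump k x := by
  have hr := B.r_pos k
  rw [B.exponent_of_mem p₀ hx, localExponent, bump]
  split_ifs with h1 h2
  · have hb : 3 * B.r k ≤ dist x (B.b k) :=
      (B.notMem_a_or_notMem_b k x).resolve_left (not_le.mpr h1)
    rw [radialExponent_eq hr, cutoff_of_two_mul_le (t := dist x (B.b k)) hr (by linarith), add_zero]
  · have ha : 3 * B.r k ≤ dist x (B.a k) := not_lt.mp h1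
    rw [radialExponent_eq hr, cutoff_of_two_mul_le (t := dist x (B.a k)) hr (by linarith), zero_add]
  · have ha : 3 * B.r k ≤ dist x (B.a k) := not_lt.mp h1
    have hb : 3 * B.r k ≤ dist x (B.b k) := not_lt.mp h2
    rw [cutoff_of_two_mul_le hr (by linarith), cutoff_of_two_mul_le hr (by linarith)]
    ring

theorem log_r_neg (k : ℕ) : Real.log (B.r k) < 0 := Real.log_neg (B.r_pos k) (B.r_lt_one k)

theorem lt_level (k : ℕ) : p₀ < B.level p₀ k := by
  have : 0 < |Real.log (B.r k)| := abs_pos.mpr (B.log_r_neg k).ne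
  have : 0 < 1 / √|Real.log (B.r k)| := by positivity
  unfold level
  linarith

theorem le_exponent (x : Rn n) : p₀ ≤ B.exponent p₀ x := by
  by_cases h : ∃ k, x ∈ ball (B.c k) (7 * B.r k)
  · obtain ⟨k, hk⟩ := h
    rw [B.exponent_eq p₀ hk]
    have := mul_nonneg (sub_nonneg.mpr (B.lt_level p₀ k).le) (B.bump_nonneg k x)
    linarith
  · push Not at h
    rw [B.exponent_of_notMem p₀ h]

/-- Disjoint balls in a bounded set have summable volumes, so their volumes, and with them the
radii, tend to `0`. -/
theorem tendsto_r (hn : n ≠ 0) (hΩ : Bornology.IsBounded Ω) : Tendsto B.r atTop (𝓝 0) := by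
  have hsum : ∑' k, volume (ball (B.c k) (7 * B.r k)) ≠ ⊤ := by
    rw [← measure_iUnion B.disjoint_balls fun k => measurableSet_ball]
    exact ((measure_mono (iUnion_subset B.ball_subset)).trans_lt hΩ.measure_lt_top).ne
  have h1 := ENNReal.tendsto_atTop_zero_of_tsum_ne_top hsum
  have hω : volume (ball (0 : Rn n) 1) ≠ 0 := (measure_ball_pos volume _ one_pos).ne'
  have hωt : volume (ball (0 : Rn n) 1) ≠ ⊤ := measure_ball_lt_top.ne
  have h2 : Tendsto (fun k => ENNReal.ofReal ((7 * B.r k) ^ n)) atTop (𝓝 0) := by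
    have h3 := ENNReal.Tendsto.div_const h1 (b := volume (ball (0 : Rn n) 1)) (Or.inr hω)
    rw [ENNReal.zero_div] at h3
    refine h3.congr fun k => ?_
    rw [volume_ball_Rn hn _ (by linarith [B.r_pos k]), ENNReal.mul_div_cancel_right hω hωt]
  have h4 : Tendsto (fun k => (7 * B.r k) ^ n) atTop (𝓝 0) := by
    have h5 := (ENNReal.tendsto_toReal ENNReal.zero_ne_top).comp h2
    rw [ENNReal.toReal_zero] at h5
    refine h5.congr fun k => ?_
    have := B.r_pos k
    exact ENNReal.toReal_ofReal (by positivity)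
  have h6 := (h4.rpow_const (p := 1 / (n : ℝ)) (Or.inr (by positivity))).div_const 7
  rw [Real.zero_rpow (by positivity), zero_div] at h6
  refine h6.congr fun k => ?_
  have := B.r_pos k
  rw [one_div, Real.pow_rpow_inv_natCast (by positivity) hn]
  ring

theorem tendsto_abs_log_r (hn : n ≠ 0) (hΩ : Bornology.IsBounded Ω) :
    Tendsto (fun k => |Real.log (B.r k)|) atTop atTop := by
  have h : Tendsto B.r atTop (𝓝[>] 0) :=
    tendsto_nhdsWithin_iff.mpr ⟨B.tendsto_r hn hΩ, Eventually.of_forall B.r_pos⟩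
  exact tendsto_abs_atBot_atTop.comp (Real.tendsto_log_nhdsGT_zero.comp h)

theorem tendsto_level (hn : n ≠ 0) (hΩ : Bornology.IsBounded Ω) :
    Tendsto (B.level p₀) atTop (𝓝 p₀) := by
  have h := (tendsto_const_nhds (x := p₀)).add
    (((Real.tendsto_sqrt_atTop.comp (B.tendsto_abs_log_r hn hΩ))).inv_tendsto_atTop)
  rw [add_zero] at h
  refine h.congr fun k => ?_
  simp [level]

theorem exists_exponent_le (hn : n ≠ 0) (hΩ : Bornology.IsBounded Ω) :
    ∃ M, ∀ x, B.exponent p₀ x ≤ M := by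
  obtain ⟨M, hM⟩ := (B.tendsto_level p₀ hn hΩ).bddAbove_range
  have hM' : ∀ k, B.level p₀ k ≤ M := fun k => hM ⟨k, rfl⟩
  refine ⟨M, fun x => ?_⟩
  by_cases h : ∃ k, x ∈ ball (B.c k) (7 * B.r k)
  · obtain ⟨k, hk⟩ := h
    rw [B.exponent_eq p₀ hk]
    have := mul_le_mul_of_nonneg_left (B.bump_le_one k x)
      (sub_nonneg.mpr (B.lt_level p₀ k).le)
    linarith [hM' k]
  · push Not at h
    rw [B.exponent_of_notMem p₀ h]
    exact (B.lt_level p₀ 0).le.trans (hM' 0)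

/-- The finite sums of bumps are uniformly continuous and converge uniformly: at each point at most
one bump is nonzero, so the error after `N` terms is at most the largest `p_k - p₀` with `k ≥ N`. -/
theorem uniformContinuous_exponent (hn : n ≠ 0) (hΩ : Bornology.IsBounded Ω) :
    UniformContinuous (B.exponent p₀) := by
  refine TendstoUniformly.uniformContinuous (p := atTop)
    (F := fun N x => p₀ + ∑ k ∈ Finset.range N, (B.level p₀ k - p₀) * B.bump k x) ?_ ?_
  · rw [Metric.tendstoUniformly_iff]
    intro ε hε
    have hev := (B.tendsto_level p₀ hn hΩ).eventually (gt_mem_nhds (show p₀ < p₀ + ε by linarith))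
    obtain ⟨N₀, hN₀⟩ := eventually_atTop.mp hev
    filter_upwards [eventually_ge_atTop N₀] with N hN x
    by_cases h : ∃ k, x ∈ ball (B.c k) (7 * B.r k)
    · obtain ⟨k, hk⟩ := h
      have hother : ∀ l, l ≠ k → B.bump l x = 0 := fun l hl => B.bump_of_notMem fun hxl =>
        Set.disjoint_left.mp (B.disjoint_balls hl) hxl hk
      rw [B.exponent_eq p₀ hk]
      by_cases hkN : k < N
      · rw [Finset.sum_eq_single_of_mem k (Finset.mem_range.mpr hkN)
          (fun l _ hl => by rw [hother l hl, mul_zero]), dist_self]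
        exact hε
      · rw [Finset.sum_eq_zero fun l hl => by
          rw [hother l (by rintro rfl; exact hkN (Finset.mem_range.mp hl)), mul_zero]]
        rw [Real.dist_eq, add_zero, add_sub_cancel_left,
          abs_of_nonneg (mul_nonneg (sub_nonneg.mpr (B.lt_level p₀ k).le) (B.bump_nonneg k x))]
        have := mul_le_mul_of_nonneg_left (B.bump_le_one k x)
          (sub_nonneg.mpr (B.lt_level p₀ k).le)
        linarith [hN₀ k (hN.trans (not_lt.mp hkN))]
    · push Not at h
      rw [B.exponent_of_notMem p₀ h, Finset.sum_eq_zero fun l _ => by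
        rw [B.bump_of_notMem (h l), mul_zero], add_zero, dist_self]
      exact hε
  · refine Frequently.of_forall fun N => ?_
    refine uniformContinuous_const.add ?_
    refine Finset.uniformContinuous_sum _ fun k _ => ?_
    exact ((uniformContinuous_cutoff_dist _).add (uniformContinuous_cutoff_dist _)).const_mul' _

end BallConfiguration

/-! ### Log-Hölder conditions at the boundary and in the interior -/

theorem expSup_sub_expInf_le {n : ℕ} {q : Rn n → ℝ} {E : Set (Rn n)} (hE : IsOpen E) {m M : ℝ}
    (hmM : m ≤ M) (h : ∀ x ∈ E, m ≤ q x ∧ q x ≤ M) : expSup q E - expInf q E ≤ M - m := by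
  rcases E.eq_empty_or_nonempty with rfl | hne
  · have h1 : expSup q ∅ = 0 := by simp [expSup, essSup, limsup, limsSup]
    have h2 : expInf q ∅ = 0 := by simp [expInf, essInf, liminf, limsInf]
    rw [h1, h2]
    linarith
  · have hμ : volume.restrict E ≠ 0 := by
      rw [Ne, Measure.restrict_eq_zero]
      exact (hE.measure_pos volume hne).ne'
    have : (ae (volume.restrict E)).NeBot := ae_neBot.mpr hμ
    have hm : ∀ᵐ x ∂(volume.restrict E), m ≤ q x :=
      ae_restrict_of_forall_mem hE.measurableSet fun x hx => (h x hx).1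
    have hM : ∀ᵐ x ∂(volume.restrict E), q x ≤ M :=
      ae_restrict_of_forall_mem hE.measurableSet fun x hx => (h x hx).2
    have hbm : IsBoundedUnder (· ≥ ·) (ae (volume.restrict E)) q := ⟨m, by simpa using hm⟩
    have hbM : IsBoundedUnder (· ≤ ·) (ae (volume.restrict E)) q := ⟨M, by simpa using hM⟩
    have h1 : expSup q E ≤ M := limsup_le_of_le hbm.isCoboundedUnder_le hM
    have h2 : m ≤ expInf q E := le_liminf_of_le hbM.isCoboundedUnder_ge hm
    linarith

/-- A bounded exponent that is constant near the boundary satisfies `∂LH₀^τ`. -/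
theorem boundaryLH_of_const_near {n : ℕ} {Ω : Set (Rn n)} (hΩ : IsOpen Ω) {q : Rn n → ℝ}
    {m M μ s τ : ℝ} (hq : ∀ x ∈ Ω, m ≤ q x ∧ q x ≤ M) (hμ : 0 < μ)
    (hs : ∀ x ∈ Ω, bdryDist Ω x ≤ μ → q x = s) (hτ : 1 ≤ τ) : BoundaryLH Ω τ q := by
  set t : ℝ := τ * (μ / (1 + τ)) with ht
  have htpos : 0 < t := by positivity
  -- Points `y` of the ball have `d(y) ≤ (1 + τ) d(x)`. If `d(x) ≤ μ/(1+τ)`, the exponent is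
  -- constant on the ball and any nonnegative constant works. Otherwise the radius is at least `t`,
  -- so `-log` of it is at most `-log t`, and the total oscillation `M - m` is absorbed.
  refine ⟨max 0 ((M - m) * (-Real.log t)), fun x hx hd => ?_⟩
  set ρ := τ * bdryDist Ω x with hρ
  have hρ0 : 0 ≤ ρ := mul_nonneg (by linarith) infDist_nonneg
  have hlog : 0 ≤ -Real.log ρ := neg_nonneg.mpr (Real.log_nonpos hρ0 (by linarith))
  have hopen : IsOpen (ball x ρ ∩ Ω) := isOpen_ball.inter hΩ
  have hmM : m ≤ M := (hq x hx).1.trans (hq x hx).2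
  by_cases hc : bdryDist Ω x ≤ μ / (1 + τ)
  · refine (expSup_sub_expInf_le (m := s) (M := s) hopen le_rfl fun y hy => ?_).trans ?_
    · have h1 : bdryDist Ω y ≤ bdryDist Ω x + dist y x := infDist_le_infDist_add_dist
      have h2 : dist y x < ρ := hy.1
      have h3 : bdryDist Ω x * (1 + τ) ≤ μ := (le_div_iff₀ (by linarith)).mp hc
      rw [hs y hy.2 (by rw [hρ] at h2; linarith)]
      exact ⟨le_rfl, le_rfl⟩
    · rw [sub_self]
      exact div_nonneg (le_max_left _ _) hlog
  · have htρ : t ≤ ρ := mul_le_mul_of_nonneg_left (not_le.mp hc).le (by linarith)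
    have hlogρ : 0 < -Real.log ρ :=
      neg_pos.mpr (Real.log_neg (htpos.trans_le htρ) (by linarith))
    refine (expSup_sub_expInf_le hopen hmM fun y hy => hq y hy.2).trans ?_
    rw [le_div_iff₀ hlogρ]
    refine le_trans (mul_le_mul_of_nonneg_left ?_ (by linarith)) (le_max_right _ _)
    exact neg_le_neg (Real.log_le_log htpos htρ)

namespace BallConfiguration

variable {n : ℕ} {Ω : Set (Rn n)} (B : BallConfiguration Ω) (p₀ : ℝ)

theorem bump_eq_one_of_dist_le {k : ℕ} {x : Rn n}
    (h : dist x (B.a k) ≤ B.r k ∨ dist x (B.b k) ≤ B.r k) : B.bump k x = 1 := by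
  have hr := B.r_pos k
  refine le_antisymm (B.bump_le_one k x) ?_
  unfold bump
  rcases h with h | h
  · rw [cutoff_of_le hr h]; linarith [cutoff_nonneg (B.r k) (dist x (B.b k))]
  · rw [cutoff_of_le hr h]; linarith [cutoff_nonneg (B.r k) (dist x (B.a k))]

theorem bump_eq_zero_of_le_dist {k : ℕ} {x : Rn n} (ha : 2 * B.r k ≤ dist x (B.a k))
    (hb : 2 * B.r k ≤ dist x (B.b k)) : B.bump k x = 0 := by
  have hr := B.r_pos k
  rw [bump, cutoff_of_two_mul_le hr ha, cutoff_of_two_mul_le hr hb, add_zero]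

/-- An exponent which oscillates in the balls at least as much as `p` is not log-Hölder
continuous. -/
theorem not_interiorLH (hn : n ≠ 0) (hΩ : Bornology.IsBounded Ω) {q : Rn n → ℝ} {γ : ℝ}
    (hγ : 0 < γ) (hq : ∀ k, ∀ x ∈ ball (B.c k) (7 * B.r k), ∀ y ∈ ball (B.c k) (7 * B.r k),
      γ * |B.exponent p₀ x - B.exponent p₀ y| ≤ |q x - q y|) : ¬ InteriorLH Ω q := by
  rintro ⟨C₀, hC⟩
  have hL := B.tendsto_abs_log_r hn hΩ
  have hs := Real.tendsto_sqrt_atTop.comp hL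
  -- With `L = |log r_k|`, comparing two points at distance `2r_k` would give `γ/√L ≤ C₀/(L - log
  -- 2)`, that is, `γ(L - log 2) ≤ C₀√L`. The three conditions on `k` give `2r_k < 1/2`, `√L ≥ 1`,
  -- and a violation of this inequality.
  obtain ⟨k, hk1, hk2, hk3⟩ := (((hL.eventually_gt_atTop (Real.log 4)).and
    ((hs.eventually_ge_atTop 1).and
      (hs.eventually_gt_atTop ((|C₀| + γ * Real.log 2) / γ))))).exists
  have hr := B.r_pos k
  set L := |Real.log (B.r k)| with hLdef
  have hLlog : Real.log (B.r k) = -L := by rw [hLdef, abs_of_neg (B.log_r_neg k), neg_neg]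
  have hr4 : B.r k < 1 / 4 := by
    rw [← Real.log_lt_log_iff hr (by norm_num), hLlog, one_div, Real.log_inv]
    linarith
  -- A point on the sphere of radius `2r_k`, where the exponent has just come down to `p₀`.
  let y : Rn n := B.a k + EuclideanSpace.single ⟨0, Nat.pos_of_ne_zero hn⟩ (2 * B.r k)
  have hy : dist y (B.a k) = 2 * B.r k := by
    simp [y, dist_eq_norm, abs_of_pos hr]
  have hxm : B.a k ∈ ball (B.c k) (7 * B.r k) :=
    B.ball_a_subset k (mem_ball_self (by linarith))
  have hym : y ∈ ball (B.c k) (7 * B.r k) :=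
    B.ball_a_subset k (mem_ball.mpr (by rw [hy]; linarith))
  have hb : 3 * B.r k ≤ dist y (B.b k) :=
    (B.notMem_a_or_notMem_b k y).resolve_left (by rw [hy]; linarith)
  have hpx : B.exponent p₀ (B.a k) = B.level p₀ k := by
    rw [B.exponent_eq p₀ hxm, B.bump_eq_one_of_dist_le (Or.inl (by rw [dist_self]; exact hr.le))]
    ring
  have hpy : B.exponent p₀ y = p₀ := by
    rw [B.exponent_eq p₀ hym, B.bump_eq_zero_of_le_dist hy.ge (by linarith)]
    ring
  have h1 := (hq k _ hxm _ hym).trans (hC _ (B.ball_subset k hxm) _ (B.ball_subset k hym)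
    (by rw [dist_comm, hy]; linarith))
  rw [hpx, hpy, dist_comm, hy, Real.log_mul two_ne_zero hr.ne', hLlog,
    abs_of_pos (sub_pos.mpr (B.lt_level p₀ k)), level, ← hLdef, add_sub_cancel_left] at h1
  have hlog2 : 0 < Real.log 2 := Real.log_pos one_lt_two
  have hlog4 : Real.log 4 = 2 * Real.log 2 := by
    rw [show (4 : ℝ) = 2 ^ 2 by norm_num, Real.log_pow]; norm_num
  have hL0 : 0 < L - Real.log 2 := by linarith
  simp only [Function.comp_apply] at hk2 hk3
  rw [← hLdef] at hk2 hk3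
  set s := √L with hsdef
  have hLs : L = s ^ 2 := (Real.sq_sqrt (abs_nonneg _)).symm
  have hs0 : 0 < s := by linarith
  rw [show -(Real.log 2 + -L) = L - Real.log 2 by ring, le_div_iff₀ hL0, mul_one_div,
    div_mul_eq_mul_div, div_le_iff₀ hs0] at h1
  rw [div_lt_iff₀ hγ] at hk3
  have h2 : C₀ * s ≤ |C₀| * s := mul_le_mul_of_nonneg_right (le_abs_self _) hs0.le
  have h3 : γ * Real.log 2 ≤ γ * Real.log 2 * s := le_mul_of_one_le_right (by positivity) hk2
  have h4 : (|C₀| + γ * Real.log 2) * s < s * γ * s := mul_lt_mul_of_pos_right hk3 hs0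
  rw [hLs] at h1
  nlinarith

/-- A uniformly continuous bounded exponent that is constant outside the balls and oscillates in
them at least as much as `p` is log-Hölder only at the boundary. -/
theorem onlyBoundaryLH_of (hn : n ≠ 0) (hΩo : IsOpen Ω) (hΩ : Bornology.IsBounded Ω)
    {q : Rn n → ℝ} (huc : UniformContinuous q) {m M : ℝ} (hm : 1 < m)
    (hmM : ∀ x, m ≤ q x ∧ q x ≤ M) {μ s : ℝ} (hμ : 0 < μ)
    (hs : ∀ x, bdryDist Ω x ≤ μ → q x = s) {γ : ℝ} (hγ : 0 < γ)
    (hq : ∀ k, ∀ x ∈ ball (B.c k) (7 * B.r k), ∀ y ∈ ball (B.c k) (7 * B.r k),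
      γ * |B.exponent p₀ x - B.exponent p₀ y| ≤ |q x - q y|) : OnlyBoundaryLH Ω q :=
  ⟨huc.uniformContinuousOn, ⟨m, M, hm, fun x _ => hmM x⟩,
    fun _ hτ => boundaryLH_of_const_near hΩo (fun x _ => hmM x) hμ (fun x _ => hs x) hτ,
    B.not_interiorLH p₀ hn hΩ hγ hq⟩

theorem exists_exponent_eq_near_boundary :
    ∃ μ, 0 < μ ∧ ∀ x, bdryDist Ω x ≤ μ → B.exponent p₀ x = p₀ := by
  obtain ⟨μ, hμ, h⟩ := B.far_from_boundary
  exact ⟨μ, hμ, fun x hx => B.exponent_of_notMem p₀ fun k hk => (h k x hk).not_ge hx⟩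

theorem onlyBoundaryLH_exponent (hn : n ≠ 0) (hΩo : IsOpen Ω) (hΩ : Bornology.IsBounded Ω)
    (hp₀ : 1 < p₀) : OnlyBoundaryLH Ω (B.exponent p₀) := by
  obtain ⟨M, hM⟩ := B.exists_exponent_le p₀ hn hΩ
  obtain ⟨μ, hμ, hs⟩ := B.exists_exponent_eq_near_boundary p₀
  exact B.onlyBoundaryLH_of p₀ hn hΩo hΩ (B.uniformContinuous_exponent p₀ hn hΩ) hp₀
    (fun x => ⟨B.le_exponent p₀ x, hM x⟩) hμ hs one_pos fun _ _ _ _ _ => by rw [one_mul]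

/-! ### The dual exponent -/

variable {p₀}

/-- Since `p' = 1 + 1/(p - 1)`, differences of `p'` and of `p` are comparable as long as `p - 1`
stays between positive bounds. This transfers uniform continuity and, conversely, the failure of
log-Hölder continuity. -/
theorem conjExponent_sub (hp₀ : 1 < p₀) (x y : Rn n) :
    conjExponent (B.exponent p₀) x - conjExponent (B.exponent p₀) y =
      -((B.exponent p₀ x - B.exponent p₀ y) /
        ((B.exponent p₀ x - 1) * (B.exponent p₀ y - 1))) := by
  have hx := B.le_exponent p₀ x
  have hy := B.le_exponent p₀ y
  have hx' : B.exponent p₀ x - 1 ≠ 0 := by linarith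
  have hy' : B.exponent p₀ y - 1 ≠ 0 := by linarith
  simp only [conjExponent]
  field_simp
  ring

theorem uniformContinuous_conjExponent (hn : n ≠ 0) (hΩ : Bornology.IsBounded Ω) (hp₀ : 1 < p₀) :
    UniformContinuous (conjExponent (B.exponent p₀)) := by
  rw [Metric.uniformContinuous_iff]
  intro ε hε
  have hp : 0 < p₀ - 1 := by linarith
  obtain ⟨δ, hδ, h⟩ := Metric.uniformContinuous_iff.mp (B.uniformContinuous_exponent p₀ hn hΩ)
    (ε * (p₀ - 1) ^ 2) (by positivity)
  refine ⟨δ, hδ, fun {x y} hxy => ?_⟩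
  have h1 := h hxy
  have hx := B.le_exponent p₀ x
  have hy := B.le_exponent p₀ y
  have h2 : (p₀ - 1) ^ 2 ≤ (B.exponent p₀ x - 1) * (B.exponent p₀ y - 1) := by
    rw [sq]; exact mul_le_mul (by linarith) (by linarith) hp.le (by linarith)
  have h3 : 0 < (B.exponent p₀ x - 1) * (B.exponent p₀ y - 1) := by nlinarith
  rw [Real.dist_eq] at h1 ⊢
  rw [B.conjExponent_sub hp₀, abs_neg, abs_div, abs_of_pos h3, div_lt_iff₀ h3]
  exact h1.trans_le (mul_le_mul_of_nonneg_left h2 hε.le)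

theorem exists_conjExponent_bounds (hn : n ≠ 0) (hΩ : Bornology.IsBounded Ω) (hp₀ : 1 < p₀) :
    ∃ m, 1 < m ∧ ∀ x, m ≤ conjExponent (B.exponent p₀) x ∧
      conjExponent (B.exponent p₀) x ≤ p₀ / (p₀ - 1) := by
  obtain ⟨M, hM⟩ := B.exists_exponent_le p₀ hn hΩ
  have hp₀M : p₀ ≤ M := (B.le_exponent p₀ 0).trans (hM 0)
  refine ⟨M / (M - 1), (one_lt_div (by linarith)).mpr (by linarith), fun x => ?_⟩
  have hx := B.le_exponent p₀ x
  have hx' := hM x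
  constructor
  · rw [conjExponent, div_le_div_iff₀ (by linarith) (by linarith)]
    nlinarith
  · rw [conjExponent, div_le_div_iff₀ (by linarith) (by linarith)]
    nlinarith

theorem onlyBoundaryLH_conjExponent (hn : n ≠ 0) (hΩo : IsOpen Ω) (hΩ : Bornology.IsBounded Ω)
    (hp₀ : 1 < p₀) : OnlyBoundaryLH Ω (conjExponent (B.exponent p₀)) := by
  obtain ⟨M, hM⟩ := B.exists_exponent_le p₀ hn hΩ
  obtain ⟨m, hm, hmM⟩ := B.exists_conjExponent_bounds hn hΩ hp₀
  obtain ⟨μ, hμ, hs⟩ := B.exists_exponent_eq_near_boundary p₀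
  have hp₀M : p₀ ≤ M := (B.le_exponent p₀ 0).trans (hM 0)
  have hM1 : 0 < M - 1 := by linarith
  refine B.onlyBoundaryLH_of p₀ hn hΩo hΩ (B.uniformContinuous_conjExponent hn hΩ hp₀) hm
    hmM hμ (s := p₀ / (p₀ - 1)) (fun x hx => by rw [conjExponent, hs x hx])
    (γ := 1 / ((M - 1) * (M - 1))) (by positivity) fun _ x _ y _ => ?_
  have hx := B.le_exponent p₀ x
  have hy := B.le_exponent p₀ y
  have h3 : 0 < (B.exponent p₀ x - 1) * (B.exponent p₀ y - 1) :=
    mul_pos (by linarith) (by linarith)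
  rw [B.conjExponent_sub hp₀, abs_neg, abs_div, abs_of_pos h3, one_div_mul_eq_div]
  refine div_le_div_of_nonneg_left (abs_nonneg _) h3 ?_
  exact mul_le_mul (by linarith [hM x]) (by linarith [hM y]) (by linarith) hM1.le

/-- The configuration consisting of the balls with the indices `σ k`. -/
def reindex (σ : ℕ → ℕ) (hσ : Function.Injective σ) : BallConfiguration Ω where
  c k := B.c (σ k)
  a k := B.a (σ k)
  b k := B.b (σ k)
  r k := B.r (σ k)
  r_pos k := B.r_pos _
  r_lt_one k := B.r_lt_one _
  disjoint_balls k l hkl := B.disjoint_balls (hσ.ne hkl)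
  ball_subset k := B.ball_subset _
  far_from_boundary := by
    obtain ⟨μ, hμ, h⟩ := B.far_from_boundary
    exact ⟨μ, hμ, fun k => h _⟩
  ball_a_subset k := B.ball_a_subset _
  ball_b_subset k := B.ball_b_subset _
  disjoint_ab k := B.disjoint_ab _

end BallConfiguration

/-- Admissible configurations of balls exist in every bounded domain. -/
theorem nonempty_ballConfiguration {n : ℕ} (hn : n ≠ 0) {Ω : Set (Rn n)} (hΩo : IsOpen Ω)
    (hΩne : Ω.Nonempty) (hΩ : Bornology.IsBounded Ω) : Nonempty (BallConfiguration Ω) := by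
  obtain ⟨x₀, hx₀⟩ := hΩne
  have : Nontrivial (Rn n) := by
    have : Nonempty (Fin n) := ⟨⟨0, Nat.pos_of_ne_zero hn⟩⟩
    infer_instance
  have hfr : (frontier Ω).Nonempty := by
    refine nonempty_frontier_iff.mpr ⟨⟨x₀, hx₀⟩, ?_⟩
    rintro rfl
    exact NormedSpace.unbounded_univ ℝ (Rn n) hΩ
  obtain ⟨ρ, hρ, hball⟩ := Metric.isOpen_iff.mp hΩo x₀ hx₀
  let i₀ : Fin n := ⟨0, Nat.pos_of_ne_zero hn⟩
  let e : ℝ → Rn n := fun t => EuclideanSpace.single i₀ t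
  have he : ∀ s t, dist (x₀ + e s) (x₀ + e t) = |s - t| := fun s t => by
    rw [dist_add_left, PiLp.dist_single_same, Real.dist_eq]
  -- The centres `s 2^(-k)` lie on a segment from `x₀`. Since `7r_k = s 2^(-k)/8`, two such balls
  -- fit in the gap `≥ s 2^(-k)/2` to later centres. The bound `s ≤ ρ/4` keeps all balls in `B(x₀,
  -- ρ/2)`. Shifting by `±3r_k` makes the `3r_k`-balls touch without overlapping and stay within
  -- `6r_k` of the centre.
  set s : ℝ := min 1 (ρ / 4) with hs
  have hs0 : 0 < s := lt_min one_pos (by linarith)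
  have hs1 : s ≤ 1 := min_le_left _ _
  have hsρ : s ≤ ρ / 4 := min_le_right _ _
  have hpow : ∀ k : ℕ, 0 < (2⁻¹ : ℝ) ^ k ∧ (2⁻¹ : ℝ) ^ k ≤ 1 := fun k =>
    ⟨by positivity, pow_le_one₀ (by norm_num) (by norm_num)⟩
  have hsub : ∀ k : ℕ, ball (x₀ + e (s * 2⁻¹ ^ k)) (7 * (s * 2⁻¹ ^ k / 56)) ⊆ ball x₀ (ρ / 2) := by
    intro k
    refine ball_subset_ball' ?_
    have h0 : dist (x₀ + e (s * 2⁻¹ ^ k)) x₀ = s * 2⁻¹ ^ k := by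
      have h1 := he (s * 2⁻¹ ^ k) 0
      have h2 : e 0 = 0 := by simp [e]
      rw [h2, add_zero, sub_zero, abs_of_pos (mul_pos hs0 (hpow k).1)] at h1
      exact h1
    rw [h0]
    have := mul_le_mul_of_nonneg_left (hpow k).2 hs0.le
    linarith
  refine ⟨{
    c := fun k => x₀ + e (s * 2⁻¹ ^ k)
    a := fun k => x₀ + e (s * 2⁻¹ ^ k + 3 * (s * 2⁻¹ ^ k / 56))
    b := fun k => x₀ + e (s * 2⁻¹ ^ k - 3 * (s * 2⁻¹ ^ k / 56))
    r := fun k => s * 2⁻¹ ^ k / 56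
    r_pos := fun k => by have := hpow k; positivity
    r_lt_one := fun k => by
      have := mul_le_mul_of_nonneg_left (hpow k).2 hs0.le
      linarith
    disjoint_balls := ?_
    ball_subset := fun k => (hsub k).trans ((ball_subset_ball (by linarith)).trans hball)
    far_from_boundary := ?_
    ball_a_subset := fun k => ball_subset_ball' ?_
    ball_b_subset := fun k => ball_subset_ball' ?_
    disjoint_ab := fun k => ball_disjoint_ball ?_ }⟩
  · have hlt : ∀ k l : ℕ, k < l → Disjoint (ball (x₀ + e (s * 2⁻¹ ^ k)) (7 * (s * 2⁻¹ ^ k / 56)))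
        (ball (x₀ + e (s * 2⁻¹ ^ l)) (7 * (s * 2⁻¹ ^ l / 56))) := by
      intro k l hkl
      refine ball_disjoint_ball ?_
      have h1 : (2⁻¹ : ℝ) ^ l ≤ 2⁻¹ ^ (k + 1) :=
        pow_le_pow_of_le_one (by norm_num) (by norm_num) hkl
      rw [pow_succ] at h1
      have h2 := mul_le_mul_of_nonneg_left h1 hs0.le
      have h3 := mul_pos hs0 (hpow k).1
      rw [he, abs_of_nonneg (by linarith)]
      linarith
    intro k l hkl
    rcases lt_or_gt_of_ne hkl with h | h
    · exact hlt k l h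
    · exact (hlt l k h).symm
  · refine ⟨ρ / 4, by linarith, fun k x hx => ?_⟩
    refine lt_of_lt_of_le (show ρ / 4 < ρ / 2 by linarith) ((le_infDist hfr).mpr fun y hy => ?_)
    have hyΩ : y ∉ ball x₀ ρ := fun h => (hΩo.frontier_eq ▸ hy).2 (hball h)
    have h1 : ρ ≤ dist y x₀ := not_lt.mp hyΩ
    have h2 : dist x x₀ < ρ / 2 := hsub k hx
    have h3 := dist_triangle y x x₀
    rw [dist_comm y x] at h3
    linarith
  · have h3 := mul_pos hs0 (hpow k).1
    rw [he, add_sub_cancel_left, abs_of_pos (by linarith)]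
    linarith
  · have h3 := mul_pos hs0 (hpow k).1
    rw [he, sub_sub_cancel_left, abs_neg, abs_of_pos (by linarith)]
    linarith
  · have h3 := mul_pos hs0 (hpow k).1
    rw [he, abs_of_nonneg (by linarith)]
    linarith

/-! ### Weak derivatives of Lipschitz functions -/

/-- The partial derivative in the `j`-th coordinate direction. -/
noncomputable def partialDeriv {n : ℕ} (j : Fin n) (f : Rn n → ℝ) (x : Rn n) : ℝ :=
  lineDeriv ℝ f x (EuclideanSpace.single j 1)

theorem partialDeriv_const {n : ℕ} (j : Fin n) (s : ℝ) (x : Rn n) :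
    partialDeriv j (fun _ => s) x = 0 := by
  simp [partialDeriv, lineDeriv]

section Lipschitz

variable {n : ℕ} {Ω : Set (Rn n)} {f : Rn n → ℝ} {K : ℝ≥0} {j : Fin n}

theorem abs_partialDeriv_le (hf : LipschitzWith K f) (x : Rn n) : |partialDeriv j f x| ≤ K := by
  have h := norm_lineDeriv_le_of_lipschitz ℝ hf (x₀ := x) (v := EuclideanSpace.single j (1 : ℝ))
  simpa [partialDeriv] using h

/-- Integration by parts for two Lipschitz functions, one of them the test function. Both integrands
vanish off `Ω`, so the integrals may be taken over the whole space. -/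
theorem hasWeakPartial_of_lipschitz (hf : LipschitzWith K f) :
    HasWeakPartial Ω f j (partialDeriv j f) := by
  refine ⟨(hf.continuous.locallyIntegrable).locallyIntegrableOn _,
    (hf.locallyIntegrable_lineDeriv _).locallyIntegrableOn _, fun φ hφ hφc hφΩ => ?_⟩
  obtain ⟨D, hD⟩ := hφ.lipschitzWith_of_hasCompactSupport hφc (by simp)
  have h := LipschitzWith.integral_lineDeriv_mul_eq (μ := volume) hf hD hφc
    (EuclideanSpace.single j (1 : ℝ))
  have hφ0 : ∀ x, x ∉ Ω → φ x = 0 := fun x hx =>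
    image_eq_zero_of_notMem_tsupport fun hx' => hx (hφΩ hx')
  have hφ1 : ∀ x, x ∉ Ω → fderiv ℝ φ x = 0 := fun x hx =>
    image_eq_zero_of_notMem_tsupport fun hx' => hx (hφΩ (tsupport_fderiv_subset ℝ hx'))
  rw [setIntegral_eq_integral_of_forall_compl_eq_zero fun x hx => by simp [hφ1 x hx],
    setIntegral_eq_integral_of_forall_compl_eq_zero fun x hx => by simp [hφ0 x hx]]
  simp only [partialDeriv]
  rw [h, ← integral_neg]
  refine integral_congr_ae (Eventually.of_forall fun x => ?_)
  simp only
  rw [((hφ.differentiable (by simp)) x).lineDeriv_eq_fderiv, map_neg]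
  ring

theorem integral_partialDeriv_eq_zero (hf : LipschitzWith K f) (hfc : HasCompactSupport f) :
    ∫ x, partialDeriv j f x = 0 := by
  -- The constant `1` serves as the other factor. The formula reverses the direction of the
  -- derivative, so it is applied to the negative basis vector.
  have h := LipschitzWith.integral_lineDeriv_mul_eq (μ := volume)
    (LipschitzWith.const (1 : ℝ) : LipschitzWith 0 fun _ : Rn n => (1 : ℝ)) hf hfc
    (-EuclideanSpace.single j (1 : ℝ))
  simpa [partialDeriv, lineDeriv] using h.symm

theorem partialDeriv_congr {f g : Rn n → ℝ} {x : Rn n} (h : f =ᶠ[𝓝 x] g) :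
    partialDeriv j f x = partialDeriv j g x := h.lineDeriv_eq

theorem integrable_partialDeriv (hf : LipschitzWith K f) (hfc : HasCompactSupport f) :
    Integrable (partialDeriv j f) := by
  have h : HasCompactSupport (partialDeriv j f) := by
    refine hfc.mono' fun x hx => ?_
    by_contra hx'
    refine hx ?_
    have : f =ᶠ[𝓝 x] fun _ => 0 := notMem_tsupport_iff_eventuallyEq.mp hx'
    rw [partialDeriv_congr this, partialDeriv_const]
  refine (integrableOn_iff_integrable_of_support_subset (subset_tsupport _)).mp ?_
  exact (hf.locallyIntegrable_lineDeriv (μ := volume) _).integrableOn_isCompact h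

end Lipschitz

theorem abs_cutoff_sub_le {r s t : ℝ} (hr : 0 < r) : |cutoff r s - cutoff r t| ≤ |s - t| / r := by
  unfold cutoff
  refine (abs_max_sub_max_le_max _ _ _ _).trans (max_le ?_ ?_)
  · rw [sub_self, abs_zero]; positivity
  · refine (abs_min_sub_min_le_max _ _ _ _).trans (max_le ?_ ?_)
    · rw [sub_self, abs_zero]; positivity
    · rw [show 2 - s / r - (2 - t / r) = -((s - t) / r) by ring, abs_neg, abs_div, abs_of_pos hr]

theorem abs_apply_le_norm {n : ℕ} (x : Rn n) (i : Fin n) : |x i| ≤ ‖x‖ := by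
  simpa using PiLp.norm_apply_le x i

/-! ### The rotation fields and their gradients -/

namespace BallConfiguration

section Rot

variable {n : ℕ}

theorem rot_add (x y : Rn n) : rot (x + y) = rot x + rot y := by
  ext i; simp [rot, Matrix.mulVec_add]

theorem rot_smul (t : ℝ) (x : Rn n) : rot (t • x) = t • rot x := by
  ext i; simp [rot, Matrix.mulVec_smul]

theorem rot_sub (x y : Rn n) : rot (x - y) = rot x - rot y := by
  ext i; simp [rot, Matrix.mulVec_sub]

theorem rot_single (i j : Fin n) : rot (EuclideanSpace.single j 1) i = rotMatrix n i j := by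
  simp [rot]

theorem rot_apply_zero {m : ℕ} (x : Rn (m + 2)) : rot x 0 = -x 1 := by
  simp [rot, Matrix.mulVec, dotProduct, Fin.sum_univ_succ, rotMatrix]

theorem rot_apply_one {m : ℕ} (x : Rn (m + 2)) : rot x 1 = x 0 := by
  simp [rot, Matrix.mulVec, dotProduct, rotMatrix]

theorem rot_apply_add_two {m : ℕ} (x : Rn (m + 2)) (i : Fin m) : rot x i.succ.succ = 0 := by
  simp [rot, Matrix.mulVec, dotProduct, rotMatrix]

theorem norm_rot_le {m : ℕ} (x : Rn (m + 2)) : ‖rot x‖ ≤ ‖x‖ := by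
  refine le_of_sq_le_sq ?_ (norm_nonneg _)
  rw [EuclideanSpace.norm_sq_eq, EuclideanSpace.norm_sq_eq, Fin.sum_univ_succ, Fin.sum_univ_succ,
    Fin.sum_univ_succ, Fin.sum_univ_succ]
  have h1 : rot x (Fin.succ 0) = x 0 := rot_apply_one x
  have h2 : (x (Fin.succ 0)) = x 1 := rfl
  simp only [rot_apply_zero, h1, h2, rot_apply_add_two, Real.norm_eq_abs, sq_abs, abs_neg]
  have : 0 ≤ ∑ i : Fin m, x i.succ.succ ^ 2 := Finset.sum_nonneg fun i _ => sq_nonneg _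
  simp only [ne_eq, OfNat.ofNat_ne_zero, not_false_eq_true, zero_pow, Finset.sum_const_zero]
  linarith

end Rot

/-- The rotation field about `z`, cut off between the radii `2r` and `3r`. -/
noncomputable def twirl {n : ℕ} (z : Rn n) (r : ℝ) (x : Rn n) : Rn n :=
  cutoff r (dist x z - r) • rot (x - z)

theorem twirl_of_dist_le {n : ℕ} {z x : Rn n} {r : ℝ} (hr : 0 < r) (h : dist x z ≤ 2 * r) :
    twirl z r x = rot (x - z) := by
  rw [twirl, cutoff_of_le hr (by linarith), one_smul]

theorem twirl_of_le_dist {n : ℕ} {z x : Rn n} {r : ℝ} (hr : 0 < r) (h : 3 * r ≤ dist x z) :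
    twirl z r x = 0 := by
  rw [twirl, cutoff_of_two_mul_le hr (by linarith), zero_smul]

theorem twirl_of_mem {n : ℕ} {z x : Rn n} {r : ℝ} (hr : 0 < r) (h₁ : 2 * r ≤ dist x z)
    (h₂ : dist x z ≤ 3 * r) : twirl z r x = (3 - dist x z / r) • rot (x - z) := by
  have h3 : 2 ≤ dist x z / r := (le_div_iff₀ hr).mpr h₁
  have h4 : dist x z / r ≤ 3 := (div_le_iff₀ hr).mpr h₂
  rw [twirl, cutoff, sub_div, div_self hr.ne', min_eq_right (by linarith),
    max_eq_right (by linarith)]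
  congr 1
  ring

/-- The constant does not depend on `r`: the cut-off has slope `1/r` and the rotation has size at
most `3r` where the cut-off acts, contributing `3`; the rotation itself contributes `1`. Taking `x`
as the point nearer to `z` ensures that `|x - z| ≤ 3r` unless both values vanish. -/
theorem lipschitzWith_twirl {m : ℕ} (z : Rn (m + 2)) {r : ℝ} (hr : 0 < r) :
    LipschitzWith 4 (twirl z r) := by
  refine LipschitzWith.of_dist_le_mul fun x y => ?_
  wlog hxy : dist x z ≤ dist y z generalizing x y
  · rw [dist_comm, dist_comm x y]; exact this y x (le_of_not_ge hxy)
  rcases le_or_gt (3 * r) (dist x z) with h | h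
  · rw [twirl_of_le_dist hr h, twirl_of_le_dist hr (h.trans hxy), dist_self]
    positivity
  · have h1 : twirl z r x - twirl z r y =
        (cutoff r (dist x z - r) - cutoff r (dist y z - r)) • rot (x - z) +
          cutoff r (dist y z - r) • rot (x - y) := by
      rw [twirl, twirl, show x - y = (x - z) - (y - z) by abel, rot_sub (x - z) (y - z), sub_smul,
        smul_sub]
      abel
    have h2 : |cutoff r (dist x z - r) - cutoff r (dist y z - r)| ≤ dist x y / r := by
      refine (abs_cutoff_sub_le hr).trans ?_
      rw [sub_sub_sub_cancel_right]
      gcongr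
      exact abs_dist_sub_le x y z
    rw [dist_eq_norm, h1]
    refine (norm_add_le _ _).trans ?_
    rw [norm_smul, norm_smul, Real.norm_eq_abs, Real.norm_eq_abs,
      abs_of_nonneg (cutoff_nonneg _ _)]
    have h3 : ‖rot (x - z)‖ ≤ 3 * r := (norm_rot_le _).trans (by rw [← dist_eq_norm]; exact h.le)
    have h4 : ‖rot (x - y)‖ ≤ dist x y := (norm_rot_le _).trans (dist_eq_norm x y).ge
    have h5 := mul_le_mul h2 h3 (norm_nonneg _) (by positivity)
    have h6 := mul_le_mul (cutoff_le_one r (dist y z - r)) h4 (norm_nonneg _) zero_le_one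
    have h7 : dist x y / r * (3 * r) = 3 * dist x y := by field_simp
    have h8 : ((4 : ℝ≥0) : ℝ) = 4 := rfl
    rw [h8]
    linarith

variable {n : ℕ} {Ω : Set (Rn n)} (B : BallConfiguration Ω)

theorem field_eq (k : ℕ) (x : Rn n) :
    B.field k x = twirl (B.a k) (B.r k) x - twirl (B.b k) (B.r k) x := by
  have hr := B.r_pos k
  have hab := B.notMem_a_or_notMem_b k x
  unfold field
  simp only [mem_ball]
  split_ifs with h1 h2 h3 h4
  · rw [twirl_of_dist_le hr h1.le, twirl_of_le_dist hr (hab.resolve_left (by linarith)), sub_zero]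
  · rw [twirl_of_mem hr (not_lt.mp h1) h2.le,
      twirl_of_le_dist hr (hab.resolve_left (by linarith)), sub_zero]
  · rw [twirl_of_le_dist hr (not_lt.mp h2), twirl_of_dist_le hr h3.le, zero_sub]
  · rw [twirl_of_le_dist hr (not_lt.mp h2), twirl_of_mem hr (not_lt.mp h3) h4.le, zero_sub]
  · rw [twirl_of_le_dist hr (not_lt.mp h2), twirl_of_le_dist hr (not_lt.mp h4), sub_zero]

/-- The distance to the boundary is at least `μ` also on the closure of the ball, so no limit point
is a boundary point of `Ω`. This makes the supports of the fields compact subsets of `Ω`. -/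
theorem closedBall_subset_of_ball_subset {k : ℕ} {z : Rn n}
    (h : ball z (3 * B.r k) ⊆ ball (B.c k) (7 * B.r k)) : closedBall z (3 * B.r k) ⊆ Ω := by
  have hr := B.r_pos k
  obtain ⟨μ, hμ, hμB⟩ := B.far_from_boundary
  rw [← closure_ball z (by linarith : 3 * B.r k ≠ 0)]
  intro x hx
  have hx1 : μ ≤ bdryDist Ω x :=
    closure_minimal (fun y hy => (hμB k y (h hy)).le)
      (isClosed_le continuous_const (continuous_infDist_pt _)) hx
  have hx2 : x ∈ closure Ω := closure_mono (h.trans (B.ball_subset k)) hx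
  by_contra hxΩ
  have hx3 : x ∈ frontier Ω := ⟨hx2, fun h => hxΩ (interior_subset h)⟩
  rw [bdryDist, infDist_zero_of_mem hx3] at hx1
  linarith

theorem tsupport_field_subset (k : ℕ) :
    tsupport (B.field k) ⊆ closedBall (B.a k) (3 * B.r k) ∪ closedBall (B.b k) (3 * B.r k) := by
  refine closure_minimal (fun x hx => ?_) (isClosed_closedBall.union isClosed_closedBall)
  by_contra h
  simp only [mem_union, mem_closedBall, not_or, not_le] at h
  refine hx ?_
  rw [field_eq, twirl_of_le_dist (B.r_pos k) h.1.le, twirl_of_le_dist (B.r_pos k) h.2.le, sub_zero]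

theorem hasCompactSupport_field_apply (k : ℕ) (i : Fin n) :
    HasCompactSupport fun x => B.field k x i := by
  have h : HasCompactSupport (B.field k) :=
    ((isCompact_closedBall _ _).union (isCompact_closedBall _ _)).of_isClosed_subset
      (isClosed_tsupport _) (B.tsupport_field_subset k)
  exact h.comp_left (g := fun y : Rn n => y i) (by simp)

theorem lipschitzWith_field_apply {m : ℕ} {Ω : Set (Rn (m + 2))} (B : BallConfiguration Ω) (k : ℕ)
    (i : Fin (m + 2)) : LipschitzWith 8 fun x => B.field k x i := by
  have h := (lipschitzWith_twirl (B.a k) (B.r_pos k)).sub (lipschitzWith_twirl (B.b k) (B.r_pos k))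
  have h' : LipschitzWith 8 (B.field k) := by
    have h8 : (8 : ℝ≥0) = 4 + 4 := by norm_num
    rw [h8]
    rw [funext (B.field_eq k)]
    exact h
  refine LipschitzWith.of_dist_le_mul fun x y => ?_
  refine le_trans ?_ (h'.dist_le_mul x y)
  rw [Real.dist_eq, dist_eq_norm]
  exact abs_apply_le_norm (B.field k x - B.field k y) i

/-- The differential matrix of `u_k`. -/
noncomputable def fieldGrad (k : ℕ) (x : Rn n) : Matrix (Fin n) (Fin n) ℝ :=
  Matrix.of fun i j => partialDeriv j (fun y => B.field k y i) x

theorem partialDeriv_rot (z x : Rn n) (i j : Fin n) :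
    partialDeriv j (fun y => rot (y - z) i) x = rotMatrix n i j := by
  have h : ∀ t : ℝ, rot (x + t • EuclideanSpace.single j (1 : ℝ) - z) i =
      rot (x - z) i + t * rotMatrix n i j := fun t => by
    rw [add_sub_right_comm, rot_add, rot_smul, PiLp.add_apply, PiLp.smul_apply, rot_single,
      smul_eq_mul]
  simp only [partialDeriv, lineDeriv, h]
  simp

theorem fieldGrad_of_mem_ball_a {k : ℕ} {x : Rn n} (hx : x ∈ ball (B.a k) (2 * B.r k)) :
    B.fieldGrad k x = rotMatrix n := by
  ext i j
  rw [← partialDeriv_rot (B.a k) x i j]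
  have h : (fun y => B.field k y i) =ᶠ[𝓝 x] fun y => rot (y - B.a k) i := by
    filter_upwards [isOpen_ball.mem_nhds hx] with y hy
    rw [field, if_pos hy]
  exact partialDeriv_congr h

theorem fieldGrad_of_mem_ball_b {k : ℕ} {x : Rn n} (hx : x ∈ ball (B.b k) (2 * B.r k)) :
    B.fieldGrad k x = -rotMatrix n := by
  have hr := B.r_pos k
  ext i j
  rw [Matrix.neg_apply, ← partialDeriv_rot (B.b k) x i j]
  have h : (fun y => B.field k y i) =ᶠ[𝓝 x] fun y => -(rot (y - B.b k) i) := by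
    filter_upwards [isOpen_ball.mem_nhds hx] with y hy
    have hy' : dist y (B.b k) < 2 * B.r k := hy
    rw [field_eq, twirl_of_dist_le hr hy'.le,
      twirl_of_le_dist hr ((B.notMem_a_or_notMem_b k y).resolve_right (by linarith)), zero_sub,
      PiLp.neg_apply]
  refine (partialDeriv_congr h).trans ?_
  simp only [partialDeriv, lineDeriv]
  exact deriv.fun_neg

theorem fieldGrad_of_lt_dist {k : ℕ} {x : Rn n} (ha : 3 * B.r k < dist x (B.a k))
    (hb : 3 * B.r k < dist x (B.b k)) : B.fieldGrad k x = 0 := by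
  ext i j
  have h : (fun y => B.field k y i) =ᶠ[𝓝 x] fun _ => 0 := by
    have h' : x ∉ tsupport (B.field k) := fun h => by
      rcases B.tsupport_field_subset k h with h | h
      · exact ha.not_ge h
      · exact hb.not_ge h
    filter_upwards [notMem_tsupport_iff_eventuallyEq.mp h'] with y hy
    simp [hy]
  exact (partialDeriv_congr h).trans (partialDeriv_const _ _ _)

/-- Outside the closed balls the field vanishes locally; the remaining spheres are null sets. -/
theorem ae_fieldGrad_eq_zero (k : ℕ) : ∀ᵐ x, x ∉ ball (B.a k) (3 * B.r k) →
    x ∉ ball (B.b k) (3 * B.r k) → B.fieldGrad k x = 0 := by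
  have hr := B.r_pos k
  have hs : ∀ z : Rn n, ∀ᵐ x, x ∉ sphere z (3 * B.r k) := fun z =>
    measure_eq_zero_iff_ae_notMem.mp (Measure.addHaar_sphere_of_ne_zero volume z (by linarith))
  filter_upwards [hs (B.a k), hs (B.b k)] with x hxa hxb ha hb
  exact B.fieldGrad_of_lt_dist (lt_of_le_of_ne (not_lt.mp ha) (Ne.symm hxa))
    (lt_of_le_of_ne (not_lt.mp hb) (Ne.symm hxb))

/-- The part of the balls where the symmetric gradient of `u_k` does not vanish. -/
def annuli (k : ℕ) : Set (Rn n) :=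
  (ball (B.a k) (3 * B.r k) \ ball (B.a k) (2 * B.r k)) ∪
    (ball (B.b k) (3 * B.r k) \ ball (B.b k) (2 * B.r k))

theorem symPart_rotMatrix : symPart (rotMatrix n) = 0 := by
  ext i j
  simp only [symPart, rotMatrix, Matrix.of_apply, Matrix.zero_apply]
  split_ifs <;> first | omega | norm_num

theorem symPart_neg (M : Matrix (Fin n) (Fin n) ℝ) : symPart (-M) = -symPart M := by
  ext i j
  simp only [symPart, Matrix.of_apply, Matrix.neg_apply]
  ring

/-- Inside the `2r`-balls the gradient is `±S`, which is skew; outside the `3r`-balls it is `0`. -/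
theorem ae_symPart_fieldGrad_eq_zero (k : ℕ) : ∀ᵐ x, x ∉ B.annuli k →
    symPart (B.fieldGrad k x) = 0 := by
  filter_upwards [B.ae_fieldGrad_eq_zero k] with x hx hxA
  by_cases ha : x ∈ ball (B.a k) (2 * B.r k)
  · rw [B.fieldGrad_of_mem_ball_a ha, symPart_rotMatrix]
  by_cases hb : x ∈ ball (B.b k) (2 * B.r k)
  · rw [B.fieldGrad_of_mem_ball_b hb, symPart_neg, symPart_rotMatrix, neg_zero]
  rw [hx (fun h => hxA (Or.inl ⟨h, ha⟩)) (fun h => hxA (Or.inr ⟨h, hb⟩))]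
  ext i j
  simp [symPart]

/-- Every partial derivative of a compactly supported Lipschitz function has integral `0`. -/
theorem skewMeanZero_fieldGrad {m : ℕ} {Ω : Set (Rn (m + 2))} (B : BallConfiguration Ω) (k : ℕ) :
    SkewMeanZero Ω (B.fieldGrad k) := by
  intro i j
  have h0 : ∀ x, x ∉ Ω → B.fieldGrad k x = 0 := fun x hx => by
    refine B.fieldGrad_of_lt_dist ?_ ?_ <;> by_contra h <;> refine hx ?_
    · exact B.closedBall_subset_of_ball_subset (B.ball_a_subset k) (not_lt.mp h)
    · exact B.closedBall_subset_of_ball_subset (B.ball_b_subset k) (not_lt.mp h)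
  rw [setIntegral_eq_integral_of_forall_compl_eq_zero fun x hx => by simp [h0 x hx, symPart]]
  have hI : ∀ i j, Integrable fun x => B.fieldGrad k x i j := fun i j =>
    integrable_partialDeriv (B.lipschitzWith_field_apply k i) (B.hasCompactSupport_field_apply k i)
  have hz : ∀ i j, ∫ x, B.fieldGrad k x i j = 0 := fun i j =>
    integral_partialDeriv_eq_zero (B.lipschitzWith_field_apply k i)
      (B.hasCompactSupport_field_apply k i)
  have h : ∀ x, B.fieldGrad k x i j - symPart (B.fieldGrad k x) i j =
      (B.fieldGrad k x i j - B.fieldGrad k x j i) / 2 := fun x => by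
    simp only [symPart, Matrix.of_apply]; ring
  simp only [h]
  rw [integral_div, integral_sub (hI i j) (hI j i), hz, hz, sub_zero, zero_div]

theorem memWVec_field {m : ℕ} {Ω : Set (Rn (m + 2))} (B : BallConfiguration Ω)
    (hΩo : IsOpen Ω) (hΩ : Bornology.IsBounded Ω) {q : Rn (m + 2) → ℝ} (hq : ∀ x ∈ Ω, 0 ≤ q x)
    (k : ℕ) : MemWVec Ω q (B.field k) (B.fieldGrad k) := by
  intro i
  have hL := B.lipschitzWith_field_apply k i
  refine ⟨fun j => hasWeakPartial_of_lipschitz hL, ?_, fun j => ?_⟩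
  · obtain ⟨K, hK⟩ := (B.hasCompactSupport_field_apply k i).exists_bound_of_continuous hL.continuous
    exact memVarLp_of_abs_le hΩo.measurableSet hΩ.measure_lt_top.ne hq
      hL.continuous.aemeasurable hK
  · exact memVarLp_of_abs_le hΩo.measurableSet hΩ.measure_lt_top.ne hq
      (measurable_lineDeriv hL.continuous).aemeasurable (fun x => abs_partialDeriv_le hL x)

end BallConfiguration

/-! ### Failure of the Korn inequality -/

/-- The volume of the unit ball. -/
noncomputable def unitBallVolume (n : ℕ) : ℝ := (volume (ball (0 : Rn n) 1)).toReal

theorem unitBallVolume_pos (n : ℕ) : 0 < unitBallVolume n :=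
  ENNReal.toReal_pos (measure_ball_pos volume _ one_pos).ne' measure_ball_lt_top.ne

theorem volume_ball_eq_ofReal {n : ℕ} (hn : n ≠ 0) (x : Rn n) {r : ℝ} (hr : 0 ≤ r) :
    volume (ball x r) = ENNReal.ofReal (r ^ n * unitBallVolume n) := by
  rw [volume_ball_Rn hn x hr, ENNReal.ofReal_mul (by positivity), unitBallVolume,
    ENNReal.ofReal_toReal measure_ball_lt_top.ne]

/-- The factor `min 1 (unitBallVolume n)` is a lower bound for the power `s` of the unit ball volume
for all `s` in `[0, 1]`. It is thus independent of `k` when `s = 1/p_k`. -/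
theorem ofReal_le_volume_ball_rpow {n : ℕ} (hn : n ≠ 0) (x : Rn n) {r s : ℝ} (hr : 0 < r)
    (hs : 0 ≤ s) (hs1 : s ≤ 1) :
    ENNReal.ofReal (min 1 (unitBallVolume n) * r ^ (n * s)) ≤ volume (ball x r) ^ s := by
  have hw := unitBallVolume_pos n
  rw [volume_ball_eq_ofReal hn x hr.le, ENNReal.ofReal_rpow_of_nonneg (by positivity) hs,
    Real.mul_rpow (by positivity) hw.le, ← Real.rpow_natCast, ← Real.rpow_mul hr.le, mul_comm]
  refine ENNReal.ofReal_le_ofReal (mul_le_mul_of_nonneg_left ?_ (by positivity))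
  have hmin : 0 < min 1 (unitBallVolume n) := lt_min one_pos hw
  calc min 1 (unitBallVolume n) = min 1 (unitBallVolume n) ^ (1 : ℝ) := (Real.rpow_one _).symm
    _ ≤ min 1 (unitBallVolume n) ^ s :=
        Real.rpow_le_rpow_of_exponent_ge hmin (min_le_left _ _) hs1
    _ ≤ unitBallVolume n ^ s := Real.rpow_le_rpow hmin.le (min_le_right _ _) hs

section Frobenius

variable {n : ℕ} (M : Matrix (Fin n) (Fin n) ℝ)

theorem abs_apply_le_frob (i j : Fin n) : |M i j| ≤ frob M := by
  refine Real.abs_le_sqrt ?_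
  have h1 : M i j ^ 2 ≤ ∑ j, M i j ^ 2 :=
    Finset.single_le_sum (f := fun j => M i j ^ 2) (fun _ _ => sq_nonneg _) (Finset.mem_univ j)
  exact h1.trans (Finset.single_le_sum (f := fun i => ∑ j, M i j ^ 2)
    (fun _ _ => Finset.sum_nonneg fun _ _ => sq_nonneg _) (Finset.mem_univ i))

theorem frob_nonneg : 0 ≤ frob M := Real.sqrt_nonneg _

theorem frob_le {M : Matrix (Fin n) (Fin n) ℝ} {K : ℝ} (hK : 0 ≤ K) (h : ∀ i j, |M i j| ≤ K) :
    frob M ≤ n * K := by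
  refine Real.sqrt_le_iff.mpr ⟨by positivity, ?_⟩
  calc ∑ i, ∑ j, M i j ^ 2 ≤ ∑ _i : Fin n, ∑ _j : Fin n, K ^ 2 :=
        Finset.sum_le_sum fun i _ => Finset.sum_le_sum fun j _ => sq_le_sq.mpr (by
          rw [abs_of_nonneg hK]; exact h i j)
    _ = (n * K) ^ 2 := by simp; ring

end Frobenius

namespace BallConfiguration

section

variable {n : ℕ} {Ω : Set (Rn n)} (B : BallConfiguration Ω)

theorem annuli_subset_ball (k : ℕ) : B.annuli k ⊆ ball (B.c k) (7 * B.r k) := by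
  rintro x (hx | hx)
  · exact B.ball_a_subset k hx.1
  · exact B.ball_b_subset k hx.1

theorem measurableSet_annuli (k : ℕ) : MeasurableSet (B.annuli k) :=
  (measurableSet_ball.diff measurableSet_ball).union (measurableSet_ball.diff measurableSet_ball)

theorem exponent_of_mem_annuli (p₀ : ℝ) {k : ℕ} {x : Rn n} (hx : x ∈ B.annuli k) :
    B.exponent p₀ x = p₀ := by
  have hr := B.r_pos k
  rw [B.exponent_eq p₀ (B.annuli_subset_ball k hx)]
  have hab := B.notMem_a_or_notMem_b k x
  rcases hx with ⟨h1, h2⟩ | ⟨h1, h2⟩ <;> rw [mem_ball] at h1 h2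
  · rw [B.bump_eq_zero_of_le_dist (not_lt.mp h2)
      (by linarith [hab.resolve_left (not_le.mpr h1)])]
    ring
  · rw [B.bump_eq_zero_of_le_dist (by linarith [hab.resolve_right (not_le.mpr h1)])
      (not_lt.mp h2)]
    ring

theorem exponent_of_dist_le (p₀ : ℝ) {k : ℕ} {x : Rn n}
    (h : dist x (B.a k) ≤ B.r k ∨ dist x (B.b k) ≤ B.r k) :
    B.exponent p₀ x = B.level p₀ k := by
  have hr := B.r_pos k
  have hx : x ∈ ball (B.c k) (7 * B.r k) := by
    rcases h with h | h
    · exact B.ball_a_subset k (mem_ball.mpr (by linarith))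
    · exact B.ball_b_subset k (mem_ball.mpr (by linarith))
  rw [B.exponent_eq p₀ hx, B.bump_eq_one_of_dist_le h]
  ring

theorem volume_annuli_rpow_le (hn : n ≠ 0) (k : ℕ) {s : ℝ} (hs : 0 ≤ s) :
    volume (B.annuli k) ^ s ≤
      ENNReal.ofReal ((2 * 3 ^ n * unitBallVolume n) ^ s * B.r k ^ (n * s)) := by
  have hr := B.r_pos k
  have hw := unitBallVolume_pos n
  have h1 : volume (B.annuli k) ≤
      ENNReal.ofReal (2 * 3 ^ n * unitBallVolume n * B.r k ^ n) := by
    refine (measure_union_le _ _).trans ?_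
    refine (add_le_add (measure_mono sdiff_subset) (measure_mono sdiff_subset)).trans ?_
    rw [volume_ball_eq_ofReal hn _ (by linarith), volume_ball_eq_ofReal hn _ (by linarith),
      ← ENNReal.ofReal_add (by positivity) (by positivity)]
    refine ENNReal.ofReal_le_ofReal (le_of_eq ?_)
    rw [mul_pow]
    ring
  refine (ENNReal.rpow_le_rpow h1 hs).trans ?_
  rw [ENNReal.ofReal_rpow_of_nonneg (by positivity) hs, Real.mul_rpow (by positivity)
    (by positivity), ← Real.rpow_natCast (B.r k), ← Real.rpow_mul hr.le]

/-- The exponent is `-n (p_k - p₀)/(p_k p₀)` and `log r_k = -(√|log r_k|)²`, so the power is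
`exp(√|log r_k| · n/(p_k p₀))`. The second factor tends to the positive limit `n/p₀²`. -/
theorem tendsto_r_rpow_atTop (p₀ : ℝ) (hp₀ : 0 < p₀) (hn : n ≠ 0) (hΩ : Bornology.IsBounded Ω) :
    Tendsto (fun k => B.r k ^ ((n : ℝ) / B.level p₀ k - (n : ℝ) / p₀)) atTop atTop := by
  have h1 := Real.tendsto_sqrt_atTop.comp (B.tendsto_abs_log_r hn hΩ)
  have h2 : Tendsto (fun k => (n : ℝ) / (B.level p₀ k * p₀)) atTop (𝓝 (n / (p₀ * p₀))) :=
    tendsto_const_nhds.div ((B.tendsto_level p₀ hn hΩ).mul_const p₀) (by positivity)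
  have hn' : (0 : ℝ) < n := by positivity
  refine (Real.tendsto_exp_atTop.comp (h1.atTop_mul_pos (by positivity) h2)).congr fun k => ?_
  have hl : p₀ < B.level p₀ k := B.lt_level p₀ k
  have hL : 0 < |Real.log (B.r k)| := abs_pos.mpr (B.log_r_neg k).ne
  have hlog : Real.log (B.r k) = -(√|Real.log (B.r k)| * √|Real.log (B.r k)|) := by
    rw [Real.mul_self_sqrt hL.le, abs_of_neg (B.log_r_neg k), neg_neg]
  have hs : 0 < √|Real.log (B.r k)| := Real.sqrt_pos.mpr hL
  have hlev : B.level p₀ k - p₀ = 1 / √|Real.log (B.r k)| := by rw [level]; ring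
  rw [Real.rpow_def_of_pos (B.r_pos k)]
  simp only [Function.comp_apply]
  congr 1
  have hl0 : 0 < B.level p₀ k := hp₀.trans hl
  rw [show (n : ℝ) / B.level p₀ k - n / p₀ =
    -(n * (B.level p₀ k - p₀) / (B.level p₀ k * p₀)) by field_simp; ring, hlev, hlog]
  have hs' : √|-(√|Real.log (B.r k)| * √|Real.log (B.r k)|)| = √|Real.log (B.r k)| := by
    rw [← hlog]
  rw [hs']
  field_simp

end

variable {m : ℕ} {Ω : Set (Rn (m + 2))} (B : BallConfiguration Ω) {p₀ : ℝ}
  {q : Rn (m + 2) → ℝ}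

theorem abs_frob_symPart_fieldGrad_le (k : ℕ) (x : Rn (m + 2)) :
    |frob (symPart (B.fieldGrad k x))| ≤ ((m + 2 : ℕ) : ℝ) * 8 := by
  rw [abs_of_nonneg (frob_nonneg _)]
  refine frob_le (by norm_num) fun i j => ?_
  have h1 : |B.fieldGrad k x i j| ≤ 8 :=
    abs_partialDeriv_le (B.lipschitzWith_field_apply k i) x
  have h2 : |B.fieldGrad k x j i| ≤ 8 :=
    abs_partialDeriv_le (B.lipschitzWith_field_apply k j) x
  rw [symPart, Matrix.of_apply, abs_le]
  rw [abs_le] at h1 h2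
  constructor <;> linarith

/-- A part of the annulus about `a_k` where the symmetric gradient is bounded away from `0`. -/
def shearRegion (k : ℕ) : Set (Rn (m + 2)) :=
  {x | 2 * B.r k < dist x (B.a k) ∧ dist x (B.a k) < 3 * B.r k ∧
    B.r k < x 0 - B.a k 0 ∧ B.r k < x 1 - B.a k 1}

theorem isOpen_shearRegion (k : ℕ) : IsOpen (B.shearRegion k) := by
  have h0 : Continuous fun x : Rn (m + 2) => x 0 - B.a k 0 := by fun_prop
  have h1 : Continuous fun x : Rn (m + 2) => x 1 - B.a k 1 := by fun_prop
  have hd : Continuous fun x : Rn (m + 2) => dist x (B.a k) := by fun_prop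
  exact (isOpen_lt continuous_const hd).inter ((isOpen_lt hd continuous_const).inter
    ((isOpen_lt continuous_const h0).inter (isOpen_lt continuous_const h1)))

theorem nonempty_shearRegion (k : ℕ) : (B.shearRegion k).Nonempty := by
  have hr := B.r_pos k
  let v : Rn (m + 2) := EuclideanSpace.single 0 (3 / 2 * B.r k) +
    EuclideanSpace.single 1 (3 / 2 * B.r k)
  have hv : ‖v‖ ^ 2 = 9 / 2 * B.r k ^ 2 := by
    rw [@norm_add_sq_real]
    simp [EuclideanSpace.inner_single_left, abs_of_pos hr]
    ring
  have hd : dist (B.a k + v) (B.a k) = ‖v‖ := by simp [dist_eq_norm]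
  refine ⟨B.a k + v, ?_, ?_, ?_, ?_⟩
  · rw [hd]
    refine lt_of_pow_lt_pow_left₀ 2 (norm_nonneg _) ?_
    rw [hv]; nlinarith
  · rw [hd]
    refine lt_of_pow_lt_pow_left₀ 2 (by positivity) ?_
    rw [hv]; nlinarith
  · simp [v]; linarith
  · simp [v]; linarith

theorem shearRegion_subset_annuli (k : ℕ) : B.shearRegion k ⊆ B.annuli k := fun _ hx =>
  Or.inl ⟨mem_ball.mpr hx.2.1, fun h => (mem_ball.mp h).not_gt hx.1⟩

theorem hasDerivAt_norm_add_smul_single {n : ℕ} (i : Fin n) {v : Rn n} (hv : v ≠ 0) :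
    HasDerivAt (fun t : ℝ => ‖v + t • EuclideanSpace.single i (1 : ℝ)‖) (v i / ‖v‖) 0 := by
  have hv' : 0 < ‖v‖ := norm_pos_iff.mpr hv
  have h1 : HasDerivAt (fun t : ℝ => v + t • EuclideanSpace.single i (1 : ℝ))
      (EuclideanSpace.single i (1 : ℝ)) 0 := by
    simpa using! ((hasDerivAt_id (0 : ℝ)).smul_const (EuclideanSpace.single i (1 : ℝ))).const_add v
  have h2 := h1.norm_sq.sqrt (by simpa using hv)
  simp only [Real.sqrt_sq (norm_nonneg _)] at h2
  refine h2.congr_deriv ?_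
  rw [zero_smul, add_zero, EuclideanSpace.inner_single_right]
  simp
  field_simp

/-- In the annulus the first component is `-(3 - |x - a|/r)(x₁ - a₁)`, with coordinates numbered
from `0`. Only the radial factor depends on `x₀`. This entry is diagonal, so it survives
symmetrization. -/
theorem fieldGrad_zero_zero {k : ℕ} {x : Rn (m + 2)} (h₁ : 2 * B.r k < dist x (B.a k))
    (h₂ : dist x (B.a k) < 3 * B.r k) : B.fieldGrad k x 0 0 =
      (x 0 - B.a k 0) * (x 1 - B.a k 1) / (B.r k * dist x (B.a k)) := by
  have hr := B.r_pos k
  have hv : x - B.a k ≠ 0 := fun h => by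
    rw [dist_eq_norm, h, norm_zero] at h₁; linarith
  have h : (fun y => B.field k y 0) =ᶠ[𝓝 x]
      fun y => -((3 - ‖y - B.a k‖ / B.r k) * (y 1 - B.a k 1)) := by
    have hd : Continuous fun x : Rn (m + 2) => dist x (B.a k) := by fun_prop
    filter_upwards [(isOpen_lt continuous_const hd).mem_nhds h₁,
      (isOpen_lt hd continuous_const).mem_nhds h₂] with y hy1 hy2
    have hy1' : 2 * B.r k < dist y (B.a k) := hy1
    have hy2' : dist y (B.a k) < 3 * B.r k := hy2
    rw [field, if_neg (by rw [mem_ball]; linarith), if_pos (mem_ball.mpr hy2'), PiLp.smul_apply,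
      rot_apply_zero, dist_eq_norm, PiLp.sub_apply, smul_eq_mul, mul_neg]
  refine (partialDeriv_congr h).trans ?_
  have h3 := hasDerivAt_norm_add_smul_single (0 : Fin (m + 2)) hv
  have h4 := ((((h3.div_const (B.r k)).const_sub 3).mul_const (x 1 - B.a k 1)).neg).deriv
  rw [partialDeriv, lineDeriv]
  simp only [add_sub_right_comm, PiLp.add_apply, PiLp.smul_apply]
  have h5 : ∀ t : ℝ, t • (EuclideanSpace.single (0 : Fin (m + 2)) (1 : ℝ)) 1 = 0 := by simp
  simp only [h5, add_zero]
  refine h4.trans ?_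
  rw [PiLp.sub_apply, dist_eq_norm]
  have := (norm_pos_iff.mpr hv).ne'
  field_simp

/-- The upper bound for the symmetric gradient. -/
theorem matNorm_symPart_fieldGrad_le (hΩo : IsOpen Ω) (hp₀ : 0 < p₀) (hqpos : ∀ x ∈ Ω, 0 < q x)
    (hq : ∀ k, EqOn q (B.exponent p₀) (ball (B.c k) (7 * B.r k))) (k : ℕ) :
    matNorm Ω q (fun x => symPart (B.fieldGrad k x)) ≤ ENNReal.ofReal (((m + 2 : ℕ) : ℝ) * 8 *
      ((2 * 3 ^ (m + 2) * unitBallVolume (m + 2)) ^ (1 / p₀) *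
        B.r k ^ (((m + 2 : ℕ) : ℝ) * (1 / p₀)))) := by
  have hE0 : volume (B.annuli k) ≠ 0 := fun h =>
    ((B.isOpen_shearRegion k).measure_pos volume (B.nonempty_shearRegion k)).ne'
      (measure_mono_null (B.shearRegion_subset_annuli k) h)
  have hEt : volume (B.annuli k) ≠ ⊤ :=
    ((measure_mono (B.annuli_subset_ball k)).trans_lt measure_ball_lt_top).ne
  refine (luxNorm_le_of_abs_le_on hΩo.measurableSet (B.measurableSet_annuli k) hp₀
    (K := ((m + 2 : ℕ) : ℝ) * 8) (by positivity) hE0 hEt hqpos (fun x hx => ?_)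
    (fun x _ => B.abs_frob_symPart_fieldGrad_le k x) ?_).trans ?_
  · rw [hq k (B.annuli_subset_ball k hx), B.exponent_of_mem_annuli p₀ hx]
  · filter_upwards [B.ae_symPart_fieldGrad_eq_zero k] with x hx _ hxA
    rw [hx hxA]
    simp [frob]
  · rw [ENNReal.ofReal_mul (p := ((m + 2 : ℕ) : ℝ) * 8) (by positivity)]
    exact mul_le_mul_right (B.volume_annuli_rpow_le (by omega) k (one_div_pos.mpr hp₀).le) _

/-- On the core the gradient is `S`, which has an entry `1`, and the exponent is `p_k`. As in the
companion bounds, `q` need agree with `p` only in the large balls, so that the result also applies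
to the combined exponent at the end. -/
theorem le_matNorm_fieldGrad (hp₀ : 1 < p₀)
    (hq : ∀ k, EqOn q (B.exponent p₀) (ball (B.c k) (7 * B.r k))) (k : ℕ) :
    ENNReal.ofReal (min 1 (unitBallVolume (m + 2)) *
      B.r k ^ (((m + 2 : ℕ) : ℝ) * (1 / B.level p₀ k))) ≤ matNorm Ω q (B.fieldGrad k) := by
  have hr := B.r_pos k
  have hl : 1 < B.level p₀ k := hp₀.trans (B.lt_level p₀ k)
  have hsub : ball (B.a k) (B.r k) ⊆ ball (B.c k) (7 * B.r k) :=
    (ball_subset_ball (by linarith)).trans (B.ball_a_subset k)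
  refine (ofReal_le_volume_ball_rpow (by omega) (B.a k) hr (by positivity)
    ((div_le_one (by linarith)).mpr hl.le)).trans ?_
  have h := le_luxNorm_of_le_abs_on (Ω := Ω) (q := q) (f := fun x => frob (B.fieldGrad k x))
    (E := ball (B.a k) (B.r k)) (s := B.level p₀ k) (δ := 1) measurableSet_ball
    (hsub.trans (B.ball_subset k)) (by linarith)
    (fun x hx => by rw [hq k (hsub hx), B.exponent_of_dist_le p₀ (Or.inl (mem_ball.mp hx).le)])
    (fun x hx => ?_)
  · rwa [ENNReal.ofReal_one, one_mul] at h
  · rw [abs_of_nonneg (frob_nonneg _),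
      B.fieldGrad_of_mem_ball_a (ball_subset_ball (by linarith) hx)]
    refine le_trans (le_of_eq ?_) (abs_apply_le_frob _ 1 0)
    simp [rotMatrix]

/-- On the open set `shearRegion` both coordinate differences exceed `r` and the distance is below
`3r`, so the diagonal entry is at least `r²/(r · 3r) = 1/3`. -/
theorem matNorm_symPart_fieldGrad_pos (hp₀ : 0 < p₀)
    (hq : ∀ k, EqOn q (B.exponent p₀) (ball (B.c k) (7 * B.r k))) (k : ℕ) :
    0 < matNorm Ω q (fun x => symPart (B.fieldGrad k x)) := by
  have hr := B.r_pos k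
  have hsub := (B.shearRegion_subset_annuli k).trans (B.annuli_subset_ball k)
  refine lt_of_lt_of_le ?_ (le_luxNorm_of_le_abs_on (δ := 1 / 3) (s := p₀)
    (B.isOpen_shearRegion k).measurableSet (hsub.trans (B.ball_subset k)) hp₀ (fun x hx => by
      rw [hq k (hsub hx), B.exponent_of_mem_annuli p₀ (B.shearRegion_subset_annuli k hx)])
    fun x hx => ?_)
  · refine ENNReal.mul_pos (by simp) (ENNReal.rpow_pos_of_nonneg ?_ (by positivity)).ne'
    exact (B.isOpen_shearRegion k).measure_pos volume (B.nonempty_shearRegion k)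
  · obtain ⟨h1, h2, h3, h4⟩ := hx
    rw [abs_of_nonneg (frob_nonneg _)]
    refine le_trans ?_ ((le_abs_self _).trans
      (abs_apply_le_frob (symPart (B.fieldGrad k x)) 0 0))
    have hd : 0 < dist x (B.a k) := by linarith
    rw [show symPart (B.fieldGrad k x) 0 0 = B.fieldGrad k x 0 0 from add_self_div_two _, B.fieldGrad_zero_zero h1 h2,
      div_le_div_iff₀ (by norm_num) (by positivity), one_mul]
    nlinarith [mul_le_mul h3.le h4.le hr.le (by linarith)]

theorem exists_quotient_lower_bound (hΩo : IsOpen Ω) (hp₀ : 1 < p₀) (hqpos : ∀ x ∈ Ω, 0 < q x)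
    (hq : ∀ k, EqOn q (B.exponent p₀) (ball (B.c k) (7 * B.r k))) :
    ∃ κ : ℝ, 0 < κ ∧ ∀ k,
      ENNReal.ofReal (κ * B.r k ^ (((m + 2 : ℕ) : ℝ) / B.level p₀ k - ((m + 2 : ℕ) : ℝ) / p₀)) ≤
        matNorm Ω q (B.fieldGrad k) / matNorm Ω q (fun x => symPart (B.fieldGrad k x)) := by
  have hw := unitBallVolume_pos (m + 2)
  set D : ℝ := ((m + 2 : ℕ) : ℝ) * 8 *
    (2 * 3 ^ (m + 2) * unitBallVolume (m + 2)) ^ (1 / p₀) with hD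
  have hDpos : 0 < D := by positivity
  refine ⟨min 1 (unitBallVolume (m + 2)) / D, by positivity, fun k => ?_⟩
  have hr := B.r_pos k
  have hup := B.matNorm_symPart_fieldGrad_le hΩo (by linarith) hqpos hq k
  have hlow := B.le_matNorm_fieldGrad hp₀ hq k
  rw [← mul_assoc, ← hD] at hup
  rw [ENNReal.le_div_iff_mul_le
    (Or.inl (B.matNorm_symPart_fieldGrad_pos (by linarith) hq k).ne')
    (Or.inl (hup.trans_lt ENNReal.ofReal_lt_top).ne)]
  refine (mul_le_mul_right hup _).trans (le_trans (le_of_eq ?_) hlow)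
  rw [← ENNReal.ofReal_mul (by positivity), Real.rpow_sub hr]
  congr 1
  rw [mul_one_div, mul_one_div]
  have : 0 < B.r k ^ (((m + 2 : ℕ) : ℝ) / p₀) := by positivity
  field_simp

theorem tendsto_quotient (hΩo : IsOpen Ω) (hΩ : Bornology.IsBounded Ω) (hp₀ : 1 < p₀)
    (hqpos : ∀ x ∈ Ω, 0 < q x)
    (hq : ∀ k, EqOn q (B.exponent p₀) (ball (B.c k) (7 * B.r k))) :
    Tendsto (fun k => matNorm Ω q (B.fieldGrad k) /
      matNorm Ω q (fun x => symPart (B.fieldGrad k x))) atTop (𝓝 ⊤) := by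
  obtain ⟨κ, hκ, h⟩ := B.exists_quotient_lower_bound hΩo hp₀ hqpos hq
  refine tendsto_nhds_top_mono' (ENNReal.tendsto_ofReal_atTop.comp ?_) h
  exact (B.tendsto_r_rpow_atTop p₀ (by linarith) (by omega) hΩ).const_mul_atTop hκ

theorem not_kornInequality (hΩo : IsOpen Ω) (hΩ : Bornology.IsBounded Ω) (hp₀ : 1 < p₀)
    (hqpos : ∀ x ∈ Ω, 0 < q x)
    (hq : ∀ k, EqOn q (B.exponent p₀) (ball (B.c k) (7 * B.r k))) : ¬ KornInequality Ω q := by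
  rintro ⟨C, hC⟩
  obtain ⟨k, hk⟩ := ((B.tendsto_quotient hΩo hΩ hp₀ hqpos hq).eventually
    (lt_mem_nhds (ENNReal.coe_lt_top (r := C)))).exists
  refine hk.not_ge (ENNReal.div_le_of_le_mul (hC (B.field k) _ ?_ (B.skewMeanZero_fieldGrad k)))
  exact B.memWVec_field hΩo hΩ (fun x hx => (hqpos x hx).le) k

end BallConfiguration

/-! ### Failure of the divergence equation -/

section Swap

variable {n : ℕ} {Ω : Set (Rn n)} {φ : Rn n → ℝ}

theorem partialDeriv_eq_fderiv (hφ : ContDiff ℝ ∞ φ) (i : Fin n) :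
    partialDeriv i φ = fun x => fderiv ℝ φ x (EuclideanSpace.single i 1) :=
  funext fun x => ((hφ.differentiable (by simp)) x).lineDeriv_eq_fderiv

theorem contDiff_partialDeriv (hφ : ContDiff ℝ ∞ φ) (i : Fin n) :
    ContDiff ℝ ∞ (partialDeriv i φ) := by
  rw [partialDeriv_eq_fderiv hφ]
  exact (hφ.fderiv_right (m := ∞) (by simp)).clm_apply contDiff_const

theorem tsupport_partialDeriv_subset (hφ : ContDiff ℝ ∞ φ) (i : Fin n) :
    tsupport (partialDeriv i φ) ⊆ tsupport φ := by
  rw [partialDeriv_eq_fderiv hφ]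
  exact tsupport_fderiv_apply_subset ℝ _

theorem hasCompactSupport_partialDeriv (hφ : ContDiff ℝ ∞ φ) (hφc : HasCompactSupport φ)
    (i : Fin n) : HasCompactSupport (partialDeriv i φ) :=
  hφc.of_isClosed_subset (isClosed_tsupport _) (tsupport_partialDeriv_subset hφ i)

theorem integrableOn_partialDeriv_mul (hφ : ContDiff ℝ ∞ φ) (hφc : HasCompactSupport φ)
    (hφΩ : tsupport φ ⊆ Ω) {g : Rn n → ℝ} (hg : LocallyIntegrableOn g Ω) (i : Fin n) :
    IntegrableOn (fun x => partialDeriv i φ x * g x) Ω := by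
  have h1 : IntegrableOn g (tsupport φ) := hg.integrableOn_compact_subset hφΩ hφc
  have h2 := h1.continuousOn_mul (contDiff_partialDeriv hφ i).continuous.continuousOn hφc
  refine ((integrableOn_iff_integrable_of_support_subset fun x hx => ?_).mp h2).integrableOn
  exact tsupport_partialDeriv_subset hφ i (subset_tsupport _ (left_ne_zero_of_mul hx))

/-- Integrating by parts twice exchanges the derivatives of a test function and of `f`. -/
theorem HasWeakGradient.integral_partialDeriv_mul_comm {f : Rn n → ℝ} {g : Rn n → Rn n}
    (hg : HasWeakGradient Ω f g) (hφ : ContDiff ℝ ∞ φ) (hφc : HasCompactSupport φ)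
    (hφΩ : tsupport φ ⊆ Ω) (i j : Fin n) :
    ∫ x in Ω, partialDeriv i φ x * g x j = ∫ x in Ω, partialDeriv j φ x * g x i := by
  have key : ∀ i j : Fin n, ∫ x in Ω, partialDeriv i φ x * g x j = -∫ x in Ω, f x *
      fderiv ℝ (fderiv ℝ φ) x (EuclideanSpace.single j 1) (EuclideanSpace.single i 1) := by
    intro i j
    have h := (hg j).2.2 (partialDeriv i φ) (contDiff_partialDeriv hφ i)
      (hasCompactSupport_partialDeriv hφ hφc i) ((tsupport_partialDeriv_subset hφ i).trans hφΩ)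
    have h1 : ∀ x, fderiv ℝ (partialDeriv i φ) x (EuclideanSpace.single j 1) =
        fderiv ℝ (fderiv ℝ φ) x (EuclideanSpace.single j 1) (EuclideanSpace.single i 1) := by
      intro x
      have hd : DifferentiableAt ℝ (fderiv ℝ φ) x :=
        (hφ.fderiv_right (m := ∞) (by simp)).differentiable (by simp) x
      rw [partialDeriv_eq_fderiv hφ, fderiv_clm_apply hd (differentiableAt_const _)]
      simp
    simp only [h1] at h
    rw [h, neg_neg]
    simp only [mul_comm]
  rw [key, key]
  have hsymm : ∀ x, IsSymmSndFDerivAt ℝ φ x := fun x =>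
    (hφ.contDiffAt (x := x)).isSymmSndFDerivAt (by simpa using! ENat.LEInfty.out)
  congr 2
  funext x
  rw [(hsymm x).eq]

end Swap

/-! ### The null Lagrangian pairing two gradients -/

section KornForm

variable {m : ℕ}

/-- A bilinear expression in two gradients, which is a null Lagrangian. If the first gradient is
skew and constant it is a multiple of the trace of the second. -/
def kornForm (D V : Matrix (Fin (m + 2)) (Fin (m + 2)) ℝ) : ℝ :=
  ∑ k, ((D 1 0 * V k k - D 1 k * V k 0) - (D 0 1 * V k k - D 0 k * V k 1)) -
    (D 0 1 * V 0 0 - D 0 0 * V 0 1) - (D 1 1 * V 1 0 - D 1 0 * V 1 1)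

/-- The sum over `k` gives `2 tr V - V 0 0 - V 1 1`; the two correction terms in `kornForm` restore
the missing diagonal entries. -/
theorem kornForm_rotMatrix (V : Matrix (Fin (m + 2)) (Fin (m + 2)) ℝ) :
    kornForm (BallConfiguration.rotMatrix (m + 2)) V = 2 * V.trace := by
  simp only [kornForm, Matrix.trace, Matrix.diag_apply, Fin.sum_univ_succ (n := m + 1),
    Fin.sum_univ_succ (n := m), mul_add, Finset.mul_sum]
  simp [BallConfiguration.rotMatrix]
  simp only [← two_mul]
  ring

theorem kornForm_neg (D V : Matrix (Fin (m + 2)) (Fin (m + 2)) ℝ) :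
    kornForm (-D) V = -kornForm D V := by
  simp only [kornForm, Matrix.neg_apply, neg_sub, neg_mul]
  have : ∀ k, -(D 1 0 * V k k) - -(D 1 k * V k 0) - (-(D 0 1 * V k k) - -(D 0 k * V k 1)) =
      -((D 1 0 * V k k - D 1 k * V k 0) - (D 0 1 * V k k - D 0 k * V k 1)) := fun k => by ring
  simp only [this, Finset.sum_neg_distrib]
  ring

theorem kornForm_zero (V : Matrix (Fin (m + 2)) (Fin (m + 2)) ℝ) : kornForm 0 V = 0 := by
  simp [kornForm]

theorem abs_kornForm_le {D : Matrix (Fin (m + 2)) (Fin (m + 2)) ℝ} {K : ℝ}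
    (hD : ∀ i j, |D i j| ≤ K) (V : Matrix (Fin (m + 2)) (Fin (m + 2)) ℝ) :
    |kornForm D V| ≤ (4 * (m + 2 : ℕ) + 4) * K * frob V := by
  have h : ∀ i j k l, |D i j * V k l| ≤ K * frob V := fun i j k l => by
    rw [abs_mul]
    exact mul_le_mul (hD i j) (abs_apply_le_frob V k l) (abs_nonneg _)
      ((abs_nonneg _).trans (hD i j))
  have hsum : |∑ k, ((D 1 0 * V k k - D 1 k * V k 0) - (D 0 1 * V k k - D 0 k * V k 1))| ≤
      ∑ _k : Fin (m + 2), 4 * (K * frob V) := by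
    refine (Finset.abs_sum_le_sum_abs _ _).trans (Finset.sum_le_sum fun k _ => ?_)
    have h1 := abs_le.mp (h 1 0 k k)
    have h2 := abs_le.mp (h 0 1 k k)
    have h3 := abs_le.mp (h 1 k k 0)
    have h4 := abs_le.mp (h 0 k k 1)
    rw [abs_le]
    constructor <;> linarith
  rw [Finset.sum_const, Finset.card_univ, Fintype.card_fin, nsmul_eq_mul] at hsum
  have h0 := abs_le.mp hsum
  have h1 := abs_le.mp (h 0 1 0 0)
  have h2 := abs_le.mp (h 0 0 0 1)
  have h3 := abs_le.mp (h 1 1 1 0)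
  have h4 := abs_le.mp (h 1 0 1 1)
  rw [kornForm, abs_le]
  constructor <;> linarith

variable {Ω : Set (Rn (m + 2))} {w : Fin (m + 2) → Rn (m + 2) → ℝ}
  {v : Rn (m + 2) → Rn (m + 2)} {V : Rn (m + 2) → Matrix (Fin (m + 2)) (Fin (m + 2)) ℝ}

/-- Each bracket of `kornForm` is of the form `∂_j w_i ∂_l v_k - ∂_l w_i ∂_j v_k`, whose integral
vanishes by exchanging the two derivatives. Smoothness of `w` is needed because its derivatives
serve as test functions. -/
theorem integrableOn_kornForm_and_integral_eq_zero (hw : ∀ i, ContDiff ℝ ∞ (w i))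
    (hwc : ∀ i, HasCompactSupport (w i)) (hwΩ : ∀ i, tsupport (w i) ⊆ Ω)
    (hV : ∀ k, HasWeakGradient Ω (fun x => v x k) (rowField V k)) :
    IntegrableOn (fun x => kornForm (Matrix.of fun i j => partialDeriv j (w i) x) (V x)) Ω ∧
      ∫ x in Ω, kornForm (Matrix.of fun i j => partialDeriv j (w i) x) (V x) = 0 := by
  have hI : ∀ i j k l, IntegrableOn (fun x => partialDeriv j (w i) x * V x k l) Ω :=
    fun i j k l => integrableOn_partialDeriv_mul (hw i) (hwc i) (hwΩ i) (hV k l).2.1 j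
  have hsub : ∀ f g : Rn (m + 2) → ℝ, IntegrableOn f Ω → IntegrableOn g Ω →
      ∫ x in Ω, f x = ∫ x in Ω, g x →
      IntegrableOn (fun x => f x - g x) Ω ∧ ∫ x in Ω, (f x - g x) = 0 := fun f g hf hg h =>
    ⟨hf.sub hg, by rw [integral_sub hf hg, h, sub_self]⟩
  have hcomm : ∀ i j k l, IntegrableOn (fun x => partialDeriv j (w i) x * V x k l -
      partialDeriv l (w i) x * V x k j) Ω ∧ ∫ x in Ω, (partialDeriv j (w i) x * V x k l -
        partialDeriv l (w i) x * V x k j) = 0 := fun i j k l =>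
    hsub _ _ (hI i j k l) (hI i l k j)
      ((hV k).integral_partialDeriv_mul_comm (hw i) (hwc i) (hwΩ i) j l)
  have hS := fun k => hsub _ _ (hcomm 1 0 k k).1 (hcomm 0 1 k k).1
    ((hcomm 1 0 k k).2.trans (hcomm 0 1 k k).2.symm)
  have hsum := integral_finsetSum Finset.univ fun k (_ : k ∈ Finset.univ) => (hS k).1
  rw [Finset.sum_eq_zero fun k _ => (hS k).2] at hsum
  have h1 := hsub _ _ (integrable_finsetSum Finset.univ fun k _ => (hS k).1) (hcomm 0 1 0 0).1
    (hsum.trans (hcomm 0 1 0 0).2.symm)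
  exact hsub _ _ h1.1 (hcomm 1 1 1 0).1 (h1.2.trans (hcomm 1 1 1 0).2.symm)

end KornForm

namespace BallConfiguration

/-! ### Smooth rotation fields -/

section SmoothTwirl

/-- A smooth cut-off of the rotation field, supported in the ball of radius `3`. -/
noncomputable def unitSmoothTwirl {n : ℕ} (i : Fin n) (y : Rn n) : ℝ :=
  (⟨2, 3, two_pos, by norm_num⟩ : ContDiffBump (0 : Rn n)) y * rot y i

variable {n : ℕ}

theorem contDiff_rot_apply (i : Fin n) : ContDiff ℝ ∞ fun y : Rn n => rot y i := by
  simp only [rot, Matrix.mulVec, dotProduct]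
  fun_prop

theorem contDiff_unitSmoothTwirl (i : Fin n) : ContDiff ℝ ∞ (unitSmoothTwirl i) :=
  (ContDiffBump.contDiff _).mul (contDiff_rot_apply i)

theorem exists_lipschitzWith_unitSmoothTwirl (n : ℕ) :
    ∃ K : ℝ≥0, ∀ i : Fin n, LipschitzWith K (unitSmoothTwirl i) := by
  have h : ∀ i : Fin n, ∃ K : ℝ≥0, LipschitzWith K (unitSmoothTwirl i) := fun i =>
    (contDiff_unitSmoothTwirl i).lipschitzWith_of_hasCompactSupport
      (ContDiffBump.hasCompactSupport _).mul_right (by simp)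
  choose K hK using h
  exact ⟨∑ i, K i, fun i => (hK i).weaken (Finset.single_le_sum (fun _ _ => zero_le)
    (Finset.mem_univ i))⟩

/-- The `i`-th component of the smooth rotation field about `z`, cut off between the radii `2r`
and `3r`. -/
noncomputable def smoothTwirl (z : Rn n) (r : ℝ) (i : Fin n) (x : Rn n) : ℝ :=
  r * unitSmoothTwirl i (r⁻¹ • (x - z))

theorem contDiff_smoothTwirl (z : Rn n) (r : ℝ) (i : Fin n) :
    ContDiff ℝ ∞ (smoothTwirl z r i) :=
  contDiff_const.mul ((contDiff_unitSmoothTwirl i).comp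
    ((contDiff_id.sub contDiff_const).const_smul r⁻¹))

/-- The scaling `r w((x - z)/r)` preserves Lipschitz constants, which makes the gradient bounds for
the smooth fields uniform in `k`. -/
theorem lipschitzWith_smoothTwirl {K : ℝ≥0} {i : Fin n} (hK : LipschitzWith K (unitSmoothTwirl i))
    (z : Rn n) {r : ℝ} (hr : 0 < r) : LipschitzWith K (smoothTwirl z r i) := by
  refine LipschitzWith.of_dist_le_mul fun x y => ?_
  have h := hK.dist_le_mul (r⁻¹ • (x - z)) (r⁻¹ • (y - z))
  rw [dist_smul₀, dist_sub_right, Real.norm_eq_abs, abs_of_pos (inv_pos.mpr hr), Real.dist_eq] at h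
  rw [smoothTwirl, smoothTwirl, Real.dist_eq, ← mul_sub, abs_mul, abs_of_pos hr]
  refine (mul_le_mul_of_nonneg_left h hr.le).trans (le_of_eq ?_)
  field_simp

theorem smoothTwirl_of_dist_le {z x : Rn n} {r : ℝ} (hr : 0 < r) (h : dist x z ≤ 2 * r)
    (i : Fin n) : smoothTwirl z r i x = rot (x - z) i := by
  have hy : r⁻¹ • (x - z) ∈ closedBall (0 : Rn n) 2 := by
    rw [mem_closedBall_zero_iff, norm_smul, norm_inv, Real.norm_eq_abs, abs_of_pos hr,
      ← dist_eq_norm, inv_mul_le_iff₀ hr]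
    linarith
  rw [smoothTwirl, unitSmoothTwirl, ContDiffBump.one_of_mem_closedBall _ hy, one_mul, rot_smul,
    PiLp.smul_apply, smul_eq_mul, mul_inv_cancel_left₀ hr.ne']

theorem smoothTwirl_of_le_dist {z x : Rn n} {r : ℝ} (hr : 0 < r) (h : 3 * r ≤ dist x z)
    (i : Fin n) : smoothTwirl z r i x = 0 := by
  have hy : 3 ≤ dist (r⁻¹ • (x - z)) (0 : Rn n) := by
    rw [dist_zero_right, norm_smul, norm_inv, Real.norm_eq_abs, abs_of_pos hr,
      ← dist_eq_norm, le_inv_mul_iff₀ hr]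
    linarith
  rw [smoothTwirl, unitSmoothTwirl, ContDiffBump.zero_of_le_dist _ hy, zero_mul, mul_zero]

end SmoothTwirl

variable {n : ℕ} {Ω : Set (Rn n)} (B : BallConfiguration Ω)

/-- A smooth variant of the components of `u_k`. -/
noncomputable def smoothField (k : ℕ) (i : Fin n) (x : Rn n) : ℝ :=
  smoothTwirl (B.a k) (B.r k) i x - smoothTwirl (B.b k) (B.r k) i x

theorem contDiff_smoothField (k : ℕ) (i : Fin n) : ContDiff ℝ ∞ (B.smoothField k i) :=
  (contDiff_smoothTwirl _ _ _).sub (contDiff_smoothTwirl _ _ _)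

theorem tsupport_smoothField_subset (k : ℕ) (i : Fin n) : tsupport (B.smoothField k i) ⊆
    closedBall (B.a k) (3 * B.r k) ∪ closedBall (B.b k) (3 * B.r k) := by
  refine closure_minimal (fun x hx => ?_) (isClosed_closedBall.union isClosed_closedBall)
  by_contra h
  simp only [mem_union, mem_closedBall, not_or, not_le] at h
  refine hx ?_
  rw [smoothField, smoothTwirl_of_le_dist (B.r_pos k) h.1.le,
    smoothTwirl_of_le_dist (B.r_pos k) h.2.le, sub_zero]

theorem tsupport_smoothField_subset_domain (k : ℕ) (i : Fin n) :
    tsupport (B.smoothField k i) ⊆ Ω :=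
  (B.tsupport_smoothField_subset k i).trans (union_subset
    (B.closedBall_subset_of_ball_subset (B.ball_a_subset k))
    (B.closedBall_subset_of_ball_subset (B.ball_b_subset k)))

theorem hasCompactSupport_smoothField (k : ℕ) (i : Fin n) :
    HasCompactSupport (B.smoothField k i) :=
  ((isCompact_closedBall _ _).union (isCompact_closedBall _ _)).of_isClosed_subset
    (isClosed_tsupport _) (B.tsupport_smoothField_subset k i)

/-- The differential matrix of the smooth field. -/
noncomputable def smoothGrad (k : ℕ) (x : Rn n) : Matrix (Fin n) (Fin n) ℝ :=
  Matrix.of fun i j => partialDeriv j (B.smoothField k i) x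

theorem exists_abs_smoothGrad_le :
    ∃ K : ℝ, 0 < K ∧ ∀ k x i j, |B.smoothGrad k x i j| ≤ K := by
  obtain ⟨K, hK⟩ := exists_lipschitzWith_unitSmoothTwirl n
  refine ⟨(K + K : ℝ≥0) + 1, by positivity, fun k x i j => ?_⟩
  have h := (lipschitzWith_smoothTwirl (hK i) (B.a k) (B.r_pos k)).sub
    (lipschitzWith_smoothTwirl (hK i) (B.b k) (B.r_pos k))
  exact (abs_partialDeriv_le (f := B.smoothField k i) h x).trans (by linarith)

theorem smoothGrad_of_mem_ball_a {k : ℕ} {x : Rn n} (hx : x ∈ ball (B.a k) (2 * B.r k)) :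
    B.smoothGrad k x = rotMatrix n := by
  have hr := B.r_pos k
  ext i j
  rw [← partialDeriv_rot (B.a k) x i j]
  have h : B.smoothField k i =ᶠ[𝓝 x] fun y => rot (y - B.a k) i := by
    filter_upwards [isOpen_ball.mem_nhds hx] with y hy
    have hy' : dist y (B.a k) < 2 * B.r k := hy
    rw [smoothField, smoothTwirl_of_dist_le hr hy'.le, smoothTwirl_of_le_dist hr
      ((B.notMem_a_or_notMem_b k y).resolve_left (by linarith)), sub_zero]
  exact partialDeriv_congr h

theorem smoothGrad_of_mem_ball_b {k : ℕ} {x : Rn n} (hx : x ∈ ball (B.b k) (2 * B.r k)) :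
    B.smoothGrad k x = -rotMatrix n := by
  have hr := B.r_pos k
  ext i j
  rw [Matrix.neg_apply, ← partialDeriv_rot (B.b k) x i j]
  have h : B.smoothField k i =ᶠ[𝓝 x] fun y => -(rot (y - B.b k) i) := by
    filter_upwards [isOpen_ball.mem_nhds hx] with y hy
    have hy' : dist y (B.b k) < 2 * B.r k := hy
    rw [smoothField, smoothTwirl_of_dist_le hr hy'.le, smoothTwirl_of_le_dist hr
      ((B.notMem_a_or_notMem_b k y).resolve_right (by linarith)), zero_sub]
  refine (partialDeriv_congr h).trans ?_
  simp only [partialDeriv, lineDeriv]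
  exact deriv.fun_neg

theorem smoothGrad_of_lt_dist {k : ℕ} {x : Rn n} (ha : 3 * B.r k < dist x (B.a k))
    (hb : 3 * B.r k < dist x (B.b k)) : B.smoothGrad k x = 0 := by
  ext i j
  have h : B.smoothField k i =ᶠ[𝓝 x] fun _ => 0 := by
    refine notMem_tsupport_iff_eventuallyEq.mp fun h => ?_
    rcases B.tsupport_smoothField_subset k i h with h | h
    · exact ha.not_ge h
    · exact hb.not_ge h
  exact (partialDeriv_congr h).trans (partialDeriv_const _ _ _)

theorem ae_smoothGrad_eq_zero (k : ℕ) : ∀ᵐ x, x ∉ ball (B.a k) (3 * B.r k) →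
    x ∉ ball (B.b k) (3 * B.r k) → B.smoothGrad k x = 0 := by
  have hr := B.r_pos k
  have hs : ∀ z : Rn n, ∀ᵐ x, x ∉ sphere z (3 * B.r k) := fun z =>
    measure_eq_zero_iff_ae_notMem.mp (Measure.addHaar_sphere_of_ne_zero volume z (by linarith))
  filter_upwards [hs (B.a k), hs (B.b k)] with x hxa hxb ha hb
  exact B.smoothGrad_of_lt_dist (lt_of_le_of_ne (not_lt.mp ha) (Ne.symm hxa))
    (lt_of_le_of_ne (not_lt.mp hb) (Ne.symm hxb))

end BallConfiguration

theorem aemeasurable_frob {n : ℕ} {V : Rn n → Matrix (Fin n) (Fin n) ℝ} {ν : Measure (Rn n)}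
    (hV : ∀ i j, AEMeasurable (fun x => V x i j) ν) : AEMeasurable (fun x => frob (V x)) ν := by
  unfold frob
  exact Measurable.comp_aemeasurable Real.continuous_sqrt.measurable
    (Finset.aemeasurable_fun_sum _ fun i _ => Finset.aemeasurable_fun_sum _ fun j _ =>
      (hV i j).pow_const 2)

/-- Hölder's inequality on a set where the exponent is constant. -/
theorem lintegral_enorm_le_of_luxNorm_lt {n : ℕ} {Ω E : Set (Rn n)} {q f : Rn n → ℝ}
    (hΩ : MeasurableSet Ω) (hE : MeasurableSet E) (hEΩ : E ⊆ Ω) (hq : ∀ x ∈ Ω, 0 ≤ q x)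
    (hf : AEMeasurable f (volume.restrict Ω)) {s s' t : ℝ} (hs : s'.HolderConjugate s)
    (hqE : ∀ x ∈ E, q x = s') (ht : 0 < t) (h : luxNorm Ω q f < ENNReal.ofReal t) :
    ∫⁻ x in E, ‖f x‖ₑ ≤ ENNReal.ofReal t * volume E ^ (1 / s) := by
  have hm := modular_le_one_of_luxNorm_lt hΩ hq h
  have h1 : ∫⁻ x in E, ‖f x / t‖ₑ ^ s' ≤ 1 := by
    refine le_trans (le_of_eq ?_) ((lintegral_mono_set hEΩ).trans hm)
    exact setLIntegral_congr_fun hE fun x hx => by simp only [hqE x hx]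
  have hfE : AEMeasurable (fun x => ‖f x / t‖ₑ) (volume.restrict E) :=
    ((hf.mono_measure (Measure.restrict_mono hEΩ le_rfl)).div_const t).enorm
  have h2 := ENNReal.lintegral_mul_le_Lp_mul_Lq (volume.restrict E) hs hfE
    (aemeasurable_const (b := (1 : ℝ≥0∞)))
  have h3 : ∫⁻ x in E, ‖f x / t‖ₑ ≤ volume E ^ (1 / s) := by
    simp only [Pi.mul_apply, mul_one, ENNReal.one_rpow, lintegral_one, Measure.restrict_apply_univ]
      at h2
    refine h2.trans ?_
    calc _ ≤ (1 : ℝ≥0∞) ^ (1 / s') * volume E ^ (1 / s) := by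
          gcongr
          exact (one_div_pos.mpr hs.pos).le
      _ = _ := by rw [ENNReal.one_rpow, one_mul]
  calc ∫⁻ x in E, ‖f x‖ₑ = ∫⁻ x in E, ENNReal.ofReal t * ‖f x / t‖ₑ := by
        refine lintegral_congr fun x => ?_
        rw [Real.enorm_eq_ofReal_abs, Real.enorm_eq_ofReal_abs, ← ENNReal.ofReal_mul ht.le, abs_div,
          abs_of_pos ht, mul_div_cancel₀ _ ht.ne']
    _ = ENNReal.ofReal t * ∫⁻ x in E, ‖f x / t‖ₑ := lintegral_const_mul'' _ hfE
    _ ≤ _ := by gcongr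

/-! ### The dipole data and the contradiction -/

namespace BallConfiguration

section

variable {n : ℕ} {Ω : Set (Rn n)} (B : BallConfiguration Ω)

/-- The right-hand side `1_{B(a_k, r_k)} - 1_{B(b_k, r_k)}` of the divergence equation. -/
noncomputable def dipole (k : ℕ) (x : Rn n) : ℝ :=
  (ball (B.a k) (B.r k)).indicator 1 x - (ball (B.b k) (B.r k)).indicator 1 x

/-- The support of the dipole. -/
def cores (k : ℕ) : Set (Rn n) := ball (B.a k) (B.r k) ∪ ball (B.b k) (B.r k)

theorem measurableSet_cores (k : ℕ) : MeasurableSet (B.cores k) :=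
  measurableSet_ball.union measurableSet_ball

theorem cores_subset_ball (k : ℕ) : B.cores k ⊆ ball (B.c k) (7 * B.r k) := by
  have hr := B.r_pos k
  exact union_subset ((ball_subset_ball (by linarith)).trans (B.ball_a_subset k))
    ((ball_subset_ball (by linarith)).trans (B.ball_b_subset k))

theorem volume_cores (hn : n ≠ 0) (k : ℕ) :
    volume (B.cores k) = ENNReal.ofReal (2 * (B.r k ^ n * unitBallVolume n)) := by
  have hr := B.r_pos k
  have hw := unitBallVolume_pos n
  have hd : Disjoint (ball (B.a k) (B.r k)) (ball (B.b k) (B.r k)) :=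
    (B.disjoint_ab k).mono (ball_subset_ball (by linarith)) (ball_subset_ball (by linarith))
  rw [cores, measure_union hd measurableSet_ball, volume_ball_eq_ofReal hn _ hr.le,
    volume_ball_eq_ofReal hn _ hr.le, ← ENNReal.ofReal_add (by positivity) (by positivity), two_mul]

theorem abs_dipole_le (k : ℕ) (x : Rn n) : |B.dipole k x| ≤ 1 := by
  unfold dipole indicator
  split_ifs <;> simp

theorem dipole_of_notMem_cores {k : ℕ} {x : Rn n} (hx : x ∉ B.cores k) : B.dipole k x = 0 := by
  rw [dipole, indicator_of_notMem fun h => hx (Or.inl h),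
    indicator_of_notMem fun h => hx (Or.inr h), sub_zero]

theorem measurable_dipole (k : ℕ) : Measurable (B.dipole k) :=
  (measurable_one.indicator measurableSet_ball).sub (measurable_one.indicator measurableSet_ball)

theorem setIntegral_dipole (hn : n ≠ 0) (k : ℕ) : ∫ x in Ω, B.dipole k x = 0 := by
  have hr := B.r_pos k
  rw [setIntegral_eq_integral_of_forall_compl_eq_zero fun x hx => B.dipole_of_notMem_cores
    fun h => hx (B.ball_subset k (B.cores_subset_ball k h))]
  have hI : ∀ z : Rn n, Integrable ((ball z (B.r k)).indicator (1 : Rn n → ℝ)) := fun z =>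
    (integrableOn_const (C := (1 : ℝ)) measure_ball_lt_top.ne).integrable_indicator
      measurableSet_ball
  simp only [dipole]
  rw [integral_sub (hI _) (hI _), integral_indicator_one measurableSet_ball,
    integral_indicator_one measurableSet_ball, Measure.real, Measure.real,
    volume_ball_eq_ofReal hn _ hr.le, volume_ball_eq_ofReal hn _ hr.le, sub_self]

end

variable {m : ℕ} {Ω : Set (Rn (m + 2))} (B : BallConfiguration Ω)
  {v : Rn (m + 2) → Rn (m + 2)} {V : Rn (m + 2) → Matrix (Fin (m + 2)) (Fin (m + 2)) ℝ}

/-- About `b_k` both the rotation and the dipole change sign, so the two cores contribute the same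
value `2` and do not cancel. Between the radii `r_k` and `2r_k` the prescribed trace is `0`; only
the annuli are left uncontrolled. -/
theorem ae_kornForm_smoothGrad (k : ℕ)
    (hV : ∀ᵐ x ∂(volume.restrict Ω), (V x).trace = B.dipole k x) :
    ∀ᵐ x ∂(volume.restrict Ω), kornForm (B.smoothGrad k x) (V x) =
      (B.cores k).indicator (fun _ => 2) x +
        (B.annuli k).indicator (fun x => kornForm (B.smoothGrad k x) (V x)) x := by
  have hr := B.r_pos k
  filter_upwards [hV, ae_restrict_of_ae (B.ae_smoothGrad_eq_zero k)] with x hx h0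
  have hab := B.notMem_a_or_notMem_b k x
  by_cases ha : x ∈ ball (B.a k) (2 * B.r k)
  · have ha' := mem_ball.mp ha
    have hb := hab.resolve_left (by linarith)
    have hxA : x ∉ B.annuli k := by
      rintro (h | h)
      · exact h.2 ha
      · exact hb.not_gt (mem_ball.mp h.1)
    have hxb : x ∉ ball (B.b k) (B.r k) := fun h => by linarith [mem_ball.mp h]
    rw [indicator_of_notMem hxA, add_zero, B.smoothGrad_of_mem_ball_a ha, kornForm_rotMatrix, hx,
      dipole, indicator_of_notMem hxb, sub_zero]
    by_cases hxa : x ∈ ball (B.a k) (B.r k)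
    · rw [indicator_of_mem hxa, indicator_of_mem (s := B.cores k) (Or.inl hxa), Pi.one_apply, mul_one]
    · rw [indicator_of_notMem hxa, indicator_of_notMem (s := B.cores k) (by rintro (h | h) <;> contradiction),
        mul_zero]
  by_cases hb : x ∈ ball (B.b k) (2 * B.r k)
  · have hb' := mem_ball.mp hb
    have ha := hab.resolve_right (by linarith)
    have hxA : x ∉ B.annuli k := by
      rintro (h | h)
      · exact ha.not_gt (mem_ball.mp h.1)
      · exact h.2 hb
    have hxa : x ∉ ball (B.a k) (B.r k) := fun h => by linarith [mem_ball.mp h]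
    rw [indicator_of_notMem hxA, add_zero, B.smoothGrad_of_mem_ball_b hb, kornForm_neg,
      kornForm_rotMatrix, hx, dipole, indicator_of_notMem hxa, zero_sub]
    by_cases hxb : x ∈ ball (B.b k) (B.r k)
    · rw [indicator_of_mem hxb, indicator_of_mem (s := B.cores k) (Or.inr hxb), Pi.one_apply]
      norm_num
    · rw [indicator_of_notMem hxb, indicator_of_notMem (s := B.cores k) (by rintro (h | h) <;> contradiction)]
      norm_num
  have hxc : x ∉ B.cores k := by
    rintro (h | h)
    · exact ha (ball_subset_ball (by linarith) h)
    · exact hb (ball_subset_ball (by linarith) h)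
  rw [indicator_of_notMem hxc, zero_add]
  by_cases hxA : x ∈ B.annuli k
  · rw [indicator_of_mem hxA]
  · rw [indicator_of_notMem hxA, h0 (fun h => hxA (Or.inl ⟨h, ha⟩))
      (fun h => hxA (Or.inr ⟨h, hb⟩)), kornForm_zero]

/-- The total integral of `kornForm` is zero, so the contribution of the cores is balanced exactly
by that of the annuli. -/
theorem two_mul_volume_cores_le (k : ℕ)
    (hVw : ∀ i, HasWeakGradient Ω (fun x => v x i) (rowField V i))
    (hV : ∀ᵐ x ∂(volume.restrict Ω), (V x).trace = B.dipole k x) :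
    2 * volume (B.cores k) ≤ ∫⁻ x in B.annuli k, ‖kornForm (B.smoothGrad k x) (V x)‖ₑ := by
  obtain ⟨hI, h0⟩ := integrableOn_kornForm_and_integral_eq_zero (B.contDiff_smoothField k)
    (B.hasCompactSupport_smoothField k) (B.tsupport_smoothField_subset_domain k) hVw
  change IntegrableOn (fun x => kornForm (B.smoothGrad k x) (V x)) Ω at hI
  change ∫ x in Ω, kornForm (B.smoothGrad k x) (V x) = 0 at h0
  have hcΩ := (B.cores_subset_ball k).trans (B.ball_subset k)
  have hAΩ := (B.annuli_subset_ball k).trans (B.ball_subset k)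
  have hct : volume (B.cores k) ≠ ⊤ :=
    ((measure_mono (B.cores_subset_ball k)).trans_lt measure_ball_lt_top).ne
  rw [integral_congr_ae (B.ae_kornForm_smoothGrad k hV), integral_add
    ((integrableOn_const (C := (2 : ℝ)) hct).integrable_indicator
      (B.measurableSet_cores k)).integrableOn
    (hI.integrable.indicator (B.measurableSet_annuli k)),
    setIntegral_indicator (B.measurableSet_cores k),
    setIntegral_indicator (B.measurableSet_annuli k), inter_eq_self_of_subset_right hcΩ,
    inter_eq_self_of_subset_right hAΩ, setIntegral_const, smul_eq_mul] at h0
  refine le_trans (le_of_eq ?_) (enorm_integral_le_lintegral_enorm _)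
  rw [← neg_eq_of_add_eq_zero_right h0, enorm_neg, Real.enorm_eq_ofReal (by positivity),
    ENNReal.ofReal_mul (by positivity), Measure.real, ENNReal.ofReal_toReal hct, mul_comm]
  simp

variable {p₀ : ℝ} {q : Rn (m + 2) → ℝ}

/-- The divergence equation is not solvable for an exponent that is dual to `p` in the balls. -/
theorem not_divergenceSolvable (hΩo : IsOpen Ω) (hΩ : Bornology.IsBounded Ω) (hp₀ : 1 < p₀)
    (hqpos : ∀ x ∈ Ω, 0 < q x)
    (hq : ∀ k, EqOn q (conjExponent (B.exponent p₀)) (ball (B.c k) (7 * B.r k))) :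
    ¬ DivergenceSolvable Ω q := by
  rintro ⟨C, hC⟩
  have hn : m + 2 ≠ 0 := by omega
  have hw := unitBallVolume_pos (m + 2)
  set β := unitBallVolume (m + 2) with hβ
  obtain ⟨K, hK, hKB⟩ := B.exists_abs_smoothGrad_le
  set N : ℝ := (4 * (m + 2 : ℕ) + 4) * K with hN
  have hNpos : 0 < N := by positivity
  set Q : ℝ := (2 * 3 ^ (m + 2) * β) ^ (1 / p₀) with hQ
  have hQpos : 0 < Q := by positivity
  -- For every `k` the estimates below yield `2 T^(1/l) ≤ N (C + 1) Q r_k^(n/p₀)`, while `T^(1/l) ≥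
  -- min 1 β · r_k^(n/l)`. This `k` makes the two incompatible.
  obtain ⟨k, hk⟩ := ((B.tendsto_r_rpow_atTop p₀ (by linarith) hn hΩ).eventually_gt_atTop
    (N * (C + 1) * Q / min 1 β)).exists
  have hr := B.r_pos k
  have hl : 1 < B.level p₀ k := hp₀.trans (B.lt_level p₀ k)
  set l := B.level p₀ k with hldef
  set T : ℝ := 2 * (B.r k ^ (m + 2) * β) with hT
  have hTpos : 0 < T := by positivity
  have hvol : volume (B.cores k) = ENNReal.ofReal T := B.volume_cores hn k
  obtain ⟨v, V, hVW, hVt, hVn⟩ := hC (B.dipole k)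
    (memVarLp_of_abs_le hΩo.measurableSet hΩ.measure_lt_top.ne (fun x hx => (hqpos x hx).le)
      (B.measurable_dipole k).aemeasurable (B.abs_dipole_le k)) (B.setIntegral_dipole hn k)
  have hl' : 0 < l / (l - 1) := div_pos (by linarith) (by linarith)
  have hf : luxNorm Ω q (B.dipole k) ≤ ENNReal.ofReal (T ^ (1 / (l / (l - 1)))) := by
    have h := luxNorm_le_of_abs_le_on (Ω := Ω) (q := q) (f := B.dipole k) hΩo.measurableSet
      (B.measurableSet_cores k) hl' one_pos (by rw [hvol]; simpa using hTpos)
      (by rw [hvol]; simp) hqpos (fun x hx => ?_) (fun x _ => B.abs_dipole_le k x)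
      (Eventually.of_forall fun x _ hx => B.dipole_of_notMem_cores hx)
    · rwa [ENNReal.ofReal_one, one_mul, hvol, ENNReal.ofReal_rpow_of_pos hTpos] at h
    · rw [hq k (B.cores_subset_ball k hx), conjExponent, B.exponent_of_dist_le p₀
        (hx.imp (fun h => (mem_ball.mp h).le) fun h => (mem_ball.mp h).le)]
  -- Using `C + 1` instead of `C` makes `t` positive and strictly larger than the norm of `V`, so
  -- that the modular of `V / t` is at most `1`.
  set t : ℝ := (C + 1) * T ^ (1 / (l / (l - 1))) with ht
  have htpos : 0 < t := by positivity
  have hVlt : luxNorm Ω q (fun x => frob (V x)) < ENNReal.ofReal t := by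
    refine (hVn.trans (mul_le_mul_right hf _)).trans_lt ?_
    rw [← ENNReal.ofReal_coe_nnreal, ← ENNReal.ofReal_mul (by positivity)]
    refine (ENNReal.ofReal_lt_ofReal_iff htpos).mpr ?_
    exact mul_lt_mul_of_pos_right (lt_add_one _) (by positivity)
  have h1 := lintegral_enorm_le_of_luxNorm_lt hΩo.measurableSet (B.measurableSet_annuli k)
    ((B.annuli_subset_ball k).trans (B.ball_subset k)) (fun x hx => (hqpos x hx).le)
    (aemeasurable_frob fun i j => ((hVW i).1.2.2 j).1) (Real.HolderConjugate.conjExponent hp₀).symm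
    (fun x hx => by
      rw [hq k (B.annuli_subset_ball k hx), _root_.conjExponent, B.exponent_of_mem_annuli p₀ hx,
        Real.conjExponent]) htpos hVlt
  have h2 := B.two_mul_volume_cores_le k (fun i => (hVW i).1.1) hVt
  have h3 : ∫⁻ x in B.annuli k, ‖kornForm (B.smoothGrad k x) (V x)‖ₑ ≤
      ENNReal.ofReal N * ∫⁻ x in B.annuli k, ‖frob (V x)‖ₑ := by
    rw [← lintegral_const_mul' _ _ ENNReal.ofReal_ne_top]
    refine lintegral_mono fun x => ?_
    rw [Real.enorm_eq_ofReal_abs, Real.enorm_eq_ofReal_abs, ← ENNReal.ofReal_mul hNpos.le,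
      abs_of_nonneg (frob_nonneg _)]
    exact ENNReal.ofReal_le_ofReal (abs_kornForm_le (hKB k x) (V x))
  have h4 : ENNReal.ofReal (2 * T) ≤ ENNReal.ofReal (N * (t *
      (Q * B.r k ^ (((m + 2 : ℕ) : ℝ) * (1 / p₀))))) := by
    rw [ENNReal.ofReal_mul two_pos.le, ← hvol, ENNReal.ofReal_ofNat, ENNReal.ofReal_mul hNpos.le,
      ENNReal.ofReal_mul htpos.le]
    refine h2.trans (h3.trans (mul_le_mul_right (h1.trans (mul_le_mul_right ?_ _)) _))
    exact B.volume_annuli_rpow_le hn k (one_div_pos.mpr (by linarith)).le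
  rw [ENNReal.ofReal_le_ofReal_iff (by positivity)] at h4
  have hexp : 1 / (l / (l - 1)) = 1 - 1 / l := by
    have : l ≠ 0 := by linarith
    have : l - 1 ≠ 0 := by linarith
    field_simp
  -- The dual power turns `‖f‖` into `T / T^(1/l)`; the factor `T` then cancels against the volume
  -- of the cores.
  have hTl : T ^ (1 / (l / (l - 1))) = T / T ^ (1 / l) := by
    rw [hexp, Real.rpow_sub hTpos, Real.rpow_one]
  have hlow : min 1 β * B.r k ^ (((m + 2 : ℕ) : ℝ) / l) ≤ T ^ (1 / l) := by
    have h5 := ofReal_le_volume_ball_rpow hn (B.a k) hr (one_div_pos.mpr (by linarith : 0 < l)).le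
      ((div_le_one (by linarith)).mpr hl.le)
    rw [volume_ball_eq_ofReal hn _ hr.le, ENNReal.ofReal_rpow_of_pos (by positivity),
      ENNReal.ofReal_le_ofReal_iff (by positivity), mul_one_div] at h5
    refine h5.trans (Real.rpow_le_rpow (by positivity) ?_ (one_div_pos.mpr (by linarith)).le)
    rw [hT, two_mul]
    linarith [show 0 < B.r k ^ (m + 2) * β by positivity]
  rw [ht, hTl, mul_one_div] at h4
  have hTlpos : 0 < T ^ (1 / l) := by positivity
  have h6 : 2 * T ^ (1 / l) ≤ N * (C + 1) * Q * B.r k ^ (((m + 2 : ℕ) : ℝ) / p₀) := by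
    rw [show N * ((C + 1) * (T / T ^ (1 / l)) * (Q * B.r k ^ (((m + 2 : ℕ) : ℝ) / p₀))) =
      N * (C + 1) * Q * B.r k ^ (((m + 2 : ℕ) : ℝ) / p₀) * T / T ^ (1 / l) by ring,
      le_div_iff₀ hTlpos] at h4
    refine le_of_mul_le_mul_right ?_ hTpos
    linarith
  have hmin : 0 < min 1 β := lt_min one_pos hw
  rw [Real.rpow_sub hr, div_lt_div_iff₀ hmin (by positivity)] at hk
  linarith

end BallConfiguration

/-! ### One exponent for which both statements fail -/

namespace BallConfiguration

/-- Exponents of the two kinds, placed in alternating balls. -/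
theorem exists_exponent_korn_and_divergence_fail {m : ℕ} {Ω : Set (Rn (m + 2))}
    (B : BallConfiguration Ω) (hΩo : IsOpen Ω) (hΩ : Bornology.IsBounded Ω) :
    ∃ q : Rn (m + 2) → ℝ, OnlyBoundaryLH Ω q ∧ ¬ KornInequality Ω q ∧
      ¬ DivergenceSolvable Ω q := by
  have hn : m + 2 ≠ 0 := by omega
  have h2 : (1 : ℝ) < 2 := one_lt_two
  let B₀ := B.reindex (fun k => 2 * k) fun _ _ h => by simpa using h
  let B₁ := B.reindex (fun k => 2 * k + 1) fun _ _ h => by simpa using h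
  -- The value `2` is its own conjugate, so each constituent equals `2` off its own balls. Hence `q`
  -- coincides with `p` of the even balls there, with `p'` of the odd balls there, and with `2`
  -- elsewhere.
  let q : Rn (m + 2) → ℝ := fun x =>
    B₀.exponent 2 x + (conjExponent (B₁.exponent 2) x - 2)
  have hdisj : ∀ k l, Disjoint (ball (B₀.c k) (7 * B₀.r k)) (ball (B₁.c l) (7 * B₁.r l)) :=
    fun k l => B.disjoint_balls (show 2 * k ≠ 2 * l + 1 by omega)
  have hq₀ : ∀ k, EqOn q (B₀.exponent 2) (ball (B₀.c k) (7 * B₀.r k)) := fun k x hx => by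
    have h : B₁.exponent 2 x = 2 := B₁.exponent_of_notMem 2 fun l hl =>
      Set.disjoint_left.mp (hdisj k l) hx hl
    simp only [q, conjExponent, h]
    norm_num
  have hq₁ : ∀ k, EqOn q (conjExponent (B₁.exponent 2)) (ball (B₁.c k) (7 * B₁.r k)) :=
    fun k x hx => by
      have h : B₀.exponent 2 x = 2 := B₀.exponent_of_notMem 2 fun l hl =>
        Set.disjoint_left.mp (hdisj l k) hl hx
      simp only [q, h]
      ring
  obtain ⟨M, hM⟩ := B₀.exists_exponent_le 2 hn hΩ
  obtain ⟨s, hs, hsM⟩ := B₁.exists_conjExponent_bounds hn hΩ h2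
  obtain ⟨μ₀, hμ₀, h₀⟩ := B₀.exists_exponent_eq_near_boundary 2
  obtain ⟨μ₁, hμ₁, h₁⟩ := B₁.exists_exponent_eq_near_boundary 2
  -- The first constituent is at least `2` and the conjugate one at most `2/(2 - 1) = 2`, so each
  -- bound comes from one constituent alone.
  have hqs : ∀ x, s ≤ q x ∧ q x ≤ M := fun x => by
    have := hsM x
    have := B₀.le_exponent 2 x
    have := hM x
    norm_num at *
    constructor <;> simp only [q] <;> linarith
  have hqpos : ∀ x ∈ Ω, 0 < q x := fun x _ => by linarith [(hqs x).1]
  refine ⟨q, ?_, B₀.not_kornInequality hΩo hΩ h2 hqpos hq₀,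
    B₁.not_divergenceSolvable hΩo hΩ h2 hqpos hq₁⟩
  -- The oscillation in the even balls alone already rules out log-Hölder continuity.
  refine B₀.onlyBoundaryLH_of 2 hn hΩo hΩ ?_ hs hqs (lt_min hμ₀ hμ₁) (s := 2) (fun x hx => ?_)
    one_pos fun k x hx y hy => ?_
  · exact (B₀.uniformContinuous_exponent 2 hn hΩ).add
      ((B₁.uniformContinuous_conjExponent hn hΩ h2).sub uniformContinuous_const)
  · simp only [q, conjExponent, h₀ x (hx.trans (min_le_left _ _)),
      h₁ x (hx.trans (min_le_right _ _))]
    norm_num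
  · rw [hq₀ k hx, hq₀ k hy, one_mul]

end BallConfiguration

theorem mainTheorem12 (n : ℕ) (hn : 2 ≤ n) (Ω : Set (Rn n)) (hΩo : IsOpen Ω)
    (hΩc : IsConnected Ω) (hΩb : Bornology.IsBounded Ω) (p₀ : ℝ) (hp₀ : 1 < p₀) :
    -- admissible configurations of balls exist in every bounded domain
    Nonempty (BallConfiguration Ω) ∧
    -- for each of them, the exponent and the vector fields have the following properties
    (∀ B : BallConfiguration Ω,
      OnlyBoundaryLH Ω (B.exponent p₀) ∧ (∀ x ∈ Ω, p₀ ≤ B.exponent p₀ x) ∧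
      (∃ G : ℕ → Rn n → Matrix (Fin n) (Fin n) ℝ,
        (∀ k, MemWVec Ω (B.exponent p₀) (B.field k) (G k) ∧ SkewMeanZero Ω (G k) ∧
          0 < matNorm Ω (B.exponent p₀) (fun x => symPart (G k x)) ∧
          matNorm Ω (B.exponent p₀) (fun x => symPart (G k x)) < ⊤) ∧
        (∃ κ : ℝ, 0 < κ ∧ ∀ k,
          ENNReal.ofReal (κ * B.r k ^ ((n : ℝ) / B.level p₀ k - (n : ℝ) / p₀)) ≤
            matNorm Ω (B.exponent p₀) (G k) /
              matNorm Ω (B.exponent p₀) (fun x => symPart (G k x))) ∧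
        Tendsto (fun k => matNorm Ω (B.exponent p₀) (G k) /
          matNorm Ω (B.exponent p₀) (fun x => symPart (G k x))) atTop (𝓝 ⊤)) ∧
      ¬ KornInequality Ω (B.exponent p₀) ∧
      OnlyBoundaryLH Ω (conjExponent (B.exponent p₀)) ∧
      ¬ DivergenceSolvable Ω (conjExponent (B.exponent p₀))) ∧
    -- one exponent for which both the Korn inequality and the divergence equation fail
    (∃ q : Rn n → ℝ, OnlyBoundaryLH Ω q ∧ ¬ KornInequality Ω q ∧ ¬ DivergenceSolvable Ω q) := by
  obtain ⟨m, rfl⟩ : ∃ m, n = m + 2 := ⟨n - 2, by omega⟩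
  have hn0 : m + 2 ≠ 0 := by omega
  have hne := nonempty_ballConfiguration hn0 hΩo hΩc.nonempty hΩb
  refine ⟨hne, fun B => ?_, ?_⟩
  · have hpos : ∀ x ∈ Ω, 0 < B.exponent p₀ x := fun x _ => by
      linarith [B.le_exponent p₀ x]
    have hq : ∀ k, EqOn (B.exponent p₀) (B.exponent p₀) (ball (B.c k) (7 * B.r k)) :=
      fun k => eqOn_refl _ _
    obtain ⟨_, hm, hmM⟩ := B.exists_conjExponent_bounds hn0 hΩb hp₀
    refine ⟨B.onlyBoundaryLH_exponent p₀ hn0 hΩo hΩb hp₀, fun x _ => B.le_exponent p₀ x,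
      ⟨B.fieldGrad, fun k => ⟨B.memWVec_field hΩo hΩb (fun x hx => (hpos x hx).le) k,
        B.skewMeanZero_fieldGrad k, B.matNorm_symPart_fieldGrad_pos (by linarith) hq k,
        (B.matNorm_symPart_fieldGrad_le hΩo (by linarith) hpos hq k).trans_lt
          ENNReal.ofReal_lt_top⟩,
        B.exists_quotient_lower_bound hΩo hp₀ hpos hq,
        B.tendsto_quotient hΩo hΩb hp₀ hpos hq⟩,
      B.not_kornInequality hΩo hΩb hp₀ hpos hq,
      B.onlyBoundaryLH_conjExponent hn0 hΩo hΩb hp₀,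
      B.not_divergenceSolvable hΩo hΩb hp₀
        (fun x _ => by linarith [(hmM x).1]) fun k => eqOn_refl _ _⟩
  · obtain ⟨B⟩ := hne
    exact B.exists_exponent_korn_and_divergence_fail hΩo hΩb
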